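/- Let $\mathbb T=\mathbb R/2\pi\mathbb Z$, and for $s\ge 0$ let $H^s(\mathbb T)$ be the space of real-valued $u\in L^2(\mathbb T)$ with $\|u\|_{H^s}=\|(1-\partial_x^2)^{s/2}u\|_{L^2(\mathbb T)}<\infty$. Let $c\in\mathbb R\setminus\{0\}$ and let $a\in C^\infty(\mathbb T)$ be real-valued and not identically zero. Let $s\ge 0$ and $T>0$. Then for every $u_0\in H^s(\mathbb T)$ the closed-loop KdV-BBM system $$u_t-u_{txx}-cu_{xxx}+(c+1)u_x+uu_x=-a(1-\partial_x^2)[au]\quad\text{in } \mathbb T\times(0,T),\qquad u(\cdot,0)=u_0,$$ has a unique solution $u\in C([0,T];H^s(\mathbb T))$. Here $uu_x$ means $(u^2/2)_x$, and the equation is understood in the sense of distributions in time on $(0,T)$ with values in the distributions on $\mathbb T$. -/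

import Mathlib

open MeasureTheory Filter Topology
open scoped ContDiff

noncomputable section

namespace KdVBBM

instance fact_two_pi_pos : Fact (0 < 2 * Real.pi) := ⟨Real.two_pi_pos⟩

/-- The torus `ℝ / (2πℤ)`. -/
abbrev Torus : Type := AddCircle (2 * Real.pi)

/-- Real-valued square integrable functions on the torus, modulo almost everywhere equality.
(The measure is the normalized one, `dx / 2π`; this does not change the space.) -/
abbrev L2 : Type := Lp ℝ 2 (AddCircle.haarAddCircle : Measure Torus)

/-- The Fourier coefficient `û_k = (1 / 2π) ∫ u(x) e^{-ikx} dx`. -/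
def coeff (u : L2) (k : ℤ) : ℂ := fourierCoeff (fun x : Torus => ((u x : ℝ) : ℂ)) k

/-- `u ∈ H^s` (for `s ≥ 0`): the sum of `(1 + k²)^s |û_k|²` over all integers is finite. -/
def MemSobolev (s : ℝ) (u : L2) : Prop :=
  Summable fun k : ℤ => (1 + (k : ℝ) ^ 2) ^ s * ‖coeff u k‖ ^ 2

/-- The norm `‖u‖_{H^s} = ‖(1 - ∂_x²)^{s/2} u‖_{L²}`, by Parseval. It is meaningful for
`u` with `MemSobolev s u`. -/
def sobolevNorm (s : ℝ) (u : L2) : ℝ :=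
  Real.sqrt (2 * Real.pi * ∑' k : ℤ, (1 + (k : ℝ) ^ 2) ^ s * ‖coeff u k‖ ^ 2)

/-- The restriction of `u` to `[0,T]` belongs to `C([0,T]; H^s)`. -/
def ContinuousInSobolev (s T : ℝ) (u : ℝ → L2) : Prop :=
  (∀ t ∈ Set.Icc 0 T, MemSobolev s (u t)) ∧
  ∀ t ∈ Set.Icc 0 T,
    Tendsto (fun τ => sobolevNorm s (u τ - u t)) (𝓝[Set.Icc 0 T] t) (𝓝 0)

/-- `C^∞` functions on the torus, seen as `2π`-periodic functions on the line. -/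
def IsSmoothPeriodic (φ : ℝ → ℝ) : Prop :=
  ContDiff ℝ ∞ φ ∧ Function.Periodic φ (2 * Real.pi)

/-- Distributions on the torus, given through their values on test functions `φ` with
`IsSmoothPeriodic φ` (the values on other functions are never used). -/
abbrev Distr : Type := (ℝ → ℝ) → ℝ

/-- The distribution `φ ↦ ∫_0^{2π} f φ dx` of an integrable function `f` on the torus. -/
def ofFun (f : Torus → ℝ) : Distr :=
  fun φ => ∫ x in (0 : ℝ)..(2 * Real.pi), f (x : Torus) * φ x

/-- The distributional derivative `∂_x`. -/
def ddx (L : Distr) : Distr := fun φ => -L (deriv φ)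

/-- The product of a distribution with a smooth periodic function `a`. -/
def mulSmooth (a : ℝ → ℝ) (L : Distr) : Distr := fun φ => L (fun x => a x * φ x)

/-- The operator `1 - ∂_x²` on distributions. -/
def helmholtz (L : Distr) : Distr := L - ddx (ddx L)

/-- `-c v_xxx + (c+1) v_x + v v_x + a (1 - ∂_x²)[a v]` as a distribution, for `v ∈ L²`; here
`v v_x` is `(v² / 2)_x`. -/
def spatialPart (c : ℝ) (a : ℝ → ℝ) (v : L2) : Distr :=
  -(c • ddx (ddx (ddx (ofFun v)))) + (c + 1) • ddx (ofFun v)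
    + ddx (ofFun fun x => (v x) ^ 2 / 2)
    + mulSmooth a (helmholtz (mulSmooth a (ofFun v)))

/-- `u_t - u_txx - c u_xxx + (c+1) u_x + u u_x = -a (1 - ∂_x²)[a u]` on `(0,T)` in the sense of
distributions in time with values in distributions on the torus: `ψ` is the test function in
time, `φ` the one in space. -/
def SolvesEquation (c : ℝ) (a : ℝ → ℝ) (T : ℝ) (u : ℝ → L2) : Prop :=
  ∀ ψ : ℝ → ℝ, ContDiff ℝ ∞ ψ → HasCompactSupport ψ → tsupport ψ ⊆ Set.Ioo 0 T →
    ∀ φ : ℝ → ℝ, IsSmoothPeriodic φ →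
      ∫ t in (0 : ℝ)..T,
        (-(deriv ψ t) * helmholtz (ofFun (u t)) φ + ψ t * spatialPart c a (u t) φ) = 0

/-- `u ∈ C([0,T]; H^s)` solves the closed-loop system with initial state `u₀`. -/
structure IsSolution (c : ℝ) (a : ℝ → ℝ) (s T : ℝ) (u₀ : L2) (u : ℝ → L2) : Prop where
  continuousInSobolev : ContinuousInSobolev s T u
  solvesEquation : SolvesEquation c a T u
  initial : u 0 = u₀

end KdVBBM

end

open scoped ComplexConjugate

noncomputable section

namespace KdVBBM

/-! After applying (1 - ∂²)⁻¹ the equation reads u_t = Λu - Du + Q(u,u). Here Λ is skew with symbol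
i times `phase`, D = (1 - ∂²)⁻¹ a (1 - ∂²) a has order zero and so is bounded on every H^s, and
Q(f,g) = -(1 - ∂²)⁻¹∂(fg)/2 is bounded and bilinear on H^s for s ≥ 0. Since Λ may be unbounded, it
is removed by its unitary group `evol`: y = e^{-tΛ}u, with coefficients multiplied by (1 +
k²)^{s/2}, solves an ordinary differential equation in ℓ² whose field is Lipschitz on bounded sets.
Uniqueness is then Grönwall, and existence up to time T reduces to an a priori bound.

An energy estimate for the nonlinearity is available in H¹, where ∫ w² w_x = 0, but not in L². An L²
initial state is therefore split as v₀ plus an H¹ part, with v₀ small in L² (`exists_split`). If v₀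
is small enough for the given T, its solution v stays in the unit ball on [0,T]
(`exists_solution_of_small`). The remainder w = u - v solves w_t = Λw - Dw + Q(w,w) + 2Q(v,w); as Q
maps L² × H¹ to H¹ (`mixedQuad`), the H¹ energy estimate closes (`exists_perturbation`). For general
s the tame estimate `norm_quad_le` is linear in the H^s norm once the L² norm is controlled, and
Grönwall's inequality gives the bound in H^s (`exists_solution_weighted`).

Existence is obtained by truncating the field radially, so that Picard–Lindelöf covers [0,T] at
once, and by showing that the truncation is never active. Along a solution the truncation multiplies
D by some μ(t) in [0,1] and Q by μ(t)². This is why the estimates are made for a whole family of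
equations, with coefficients α and β in [0,1], and why the L² bound is uniform in them.

The distributional equation is equivalent to a scalar ordinary differential equation for each
Fourier coefficient. Testing with cosine and sine isolates a mode, and the lemma of du Bois-Reymond
makes its weak equation classical; conversely the modes are summed against the rapidly decaying
coefficients of the test function. -/

/-- Square summable complex sequences indexed by `ℤ`. -/
def Seq : Type := lp (fun _ : ℤ => ℂ) 2

/-! ### The Hilbert space ℓ² of Fourier coefficients -/

namespace Seq

instance : NormedAddCommGroup Seq := inferInstanceAs (NormedAddCommGroup (lp (fun _ : ℤ => ℂ) 2))

instance : NormedSpace ℝ Seq := inferInstanceAs (NormedSpace ℝ (lp (fun _ : ℤ => ℂ) 2))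

instance : InnerProductSpace ℂ Seq :=
  inferInstanceAs (InnerProductSpace ℂ (lp (fun _ : ℤ => ℂ) 2))

instance : CompleteSpace Seq := inferInstanceAs (CompleteSpace (lp (fun _ : ℤ => ℂ) 2))

/-- The entries of a sequence. -/
def entry (f : Seq) : ℤ → ℂ := lp.coeFnAddMonoidHom (fun _ : ℤ => ℂ) 2 f

instance : CoeFun Seq (fun _ => ℤ → ℂ) := ⟨entry⟩

/-- The element of `Seq` with given entries. -/
def mk (F : ℤ → ℂ) (hF : Memℓp F 2) : Seq := (⟨F, hF⟩ : lp (fun _ : ℤ => ℂ) 2)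

@[simp] lemma coe_mk (F : ℤ → ℂ) (hF : Memℓp F 2) : (mk F hF : ℤ → ℂ) = F := rfl

lemma ext {f g : Seq} (h : (f : ℤ → ℂ) = g) : f = g := lp.ext h

@[simp] lemma coe_add (f g : Seq) : ((f + g : Seq) : ℤ → ℂ) = (f : ℤ → ℂ) + g := rfl

@[simp] lemma coe_sub (f g : Seq) : ((f - g : Seq) : ℤ → ℂ) = (f : ℤ → ℂ) - g := rfl

@[simp] lemma coe_zero : ((0 : Seq) : ℤ → ℂ) = 0 := rfl

@[simp] lemma coe_smul (c : ℝ) (f : Seq) : ((c • f : Seq) : ℤ → ℂ) = c • (f : ℤ → ℂ) := rfl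

lemma real_smul (r : ℝ) (f : Seq) : r • f = (r : ℂ) • f := rfl

lemma continuous_eval (k : ℤ) : Continuous (fun f : Seq => f k) :=
  (lp.lipschitzWith_one_eval (E := fun _ : ℤ => ℂ) 2 k).continuous

lemma inner_eq_tsum (f g : Seq) : inner ℂ f g = ∑' k, inner ℂ (f k) (g k) :=
  lp.inner_eq_tsum (G := fun _ : ℤ => ℂ) f g

end Seq

/-! ### Weights -/

/-- The weight `(1 + k²)^(r/2)`. -/
def jap (r : ℝ) (k : ℤ) : ℝ := (1 + (k : ℝ) ^ 2) ^ (r / 2)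

lemma one_le_base (k : ℤ) : (1 : ℝ) ≤ 1 + (k : ℝ) ^ 2 := by nlinarith [sq_nonneg (k : ℝ)]

lemma base_pos (k : ℤ) : (0 : ℝ) < 1 + (k : ℝ) ^ 2 := by positivity

lemma jap_pos (r : ℝ) (k : ℤ) : 0 < jap r k := Real.rpow_pos_of_pos (base_pos k) _

lemma jap_zero (k : ℤ) : jap 0 k = 1 := by simp [jap]

lemma jap_two (k : ℤ) : jap 2 k = 1 + (k : ℝ) ^ 2 := by simp [jap]

lemma jap_add (r q : ℝ) (k : ℤ) : jap (r + q) k = jap r k * jap q k := by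
  rw [jap, add_div, Real.rpow_add (base_pos k)]; rfl

lemma jap_mul_neg (r : ℝ) (k : ℤ) : jap r k * jap (-r) k = 1 := by
  rw [← jap_add, add_neg_cancel, jap_zero]

lemma jap_neg_mul (r : ℝ) (k : ℤ) : jap (-r) k * jap r k = 1 := by
  rw [mul_comm, jap_mul_neg]

lemma jap_neg_arg (r : ℝ) (k : ℤ) : jap r (-k) = jap r k := by simp [jap]

lemma jap_mono {r q : ℝ} (h : r ≤ q) (k : ℤ) : jap r k ≤ jap q k :=
  Real.rpow_le_rpow_of_exponent_le (one_le_base k) (by linarith)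

lemma jap_le_one {r : ℝ} (h : r ≤ 0) (k : ℤ) : jap r k ≤ 1 := by
  simpa [jap_zero] using jap_mono h k

lemma one_le_jap {r : ℝ} (h : 0 ≤ r) (k : ℤ) : 1 ≤ jap r k := by
  simpa [jap_zero] using jap_mono h k

lemma jap_sq (r : ℝ) (k : ℤ) : jap r k ^ 2 = (1 + (k : ℝ) ^ 2) ^ r := by
  rw [jap, ← Real.rpow_natCast, ← Real.rpow_mul (base_pos k).le]
  congr 1; push_cast; ring

lemma abs_le_jap_one (k : ℤ) : |(k : ℝ)| ≤ jap 1 k := by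
  refine abs_le_of_sq_le_sq' ?_ (jap_pos _ _).le |> abs_le.mpr
  rw [jap_sq, Real.rpow_one]; linarith

lemma jap_peetre_of_nonneg {r : ℝ} (hr : 0 ≤ r) (k j : ℤ) :
    jap r k ≤ 2 ^ (r / 2) * jap r j * jap r (k - j) := by
  unfold jap
  rw [← Real.mul_rpow (by norm_num) (base_pos j).le,
    ← Real.mul_rpow (by positivity) (base_pos (k - j)).le]
  refine Real.rpow_le_rpow (base_pos k).le ?_ (by positivity)
  push_cast
  nlinarith [sq_nonneg ((j : ℝ) - (k - j)), sq_nonneg ((j : ℝ) * (k - j))]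

/-- Peetre's inequality. -/
lemma jap_peetre (r : ℝ) (k j : ℤ) :
    jap r k ≤ 2 ^ (|r| / 2) * jap r j * jap |r| (k - j) := by
  rcases le_total 0 r with hr | hr
  · rw [abs_of_nonneg hr]; exact jap_peetre_of_nonneg hr k j
  · rw [abs_of_nonpos hr]
    -- For a negative exponent, exchange k and j in the inequality for -r and multiply by both
    -- weights of order r.
    have h := jap_peetre_of_nonneg (r := -r) (by linarith) j k
    have h1 := mul_le_mul_of_nonneg_left h
      (mul_nonneg (jap_pos r k).le (jap_pos r j).le)
    have h2 : jap r k * jap r j * jap (-r) j = jap r k := by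
      rw [mul_assoc, jap_mul_neg, mul_one]
    have h3 : jap r k * jap r j * (2 ^ (-r / 2) * jap (-r) k * jap (-r) (j - k))
        = 2 ^ (-r / 2) * jap r j * jap (-r) (k - j) := by
      have : jap (-r) (j - k) = jap (-r) (k - j) := by rw [← jap_neg_arg, neg_sub]
      rw [this]
      linear_combination (2 ^ (-r / 2) * jap r j * jap (-r) (k - j)) * jap_mul_neg r k
    rwa [h2, h3] at h1

/-- If m is the larger of j and k - j in absolute value, then k² ≤ 4m². Unlike in Peetre's
inequality the two weights are added, so each term leaves one factor of a product without weight. -/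
lemma jap_subadd {s : ℝ} (hs : 0 ≤ s) (k j : ℤ) :
    jap s k ≤ 2 ^ s * (jap s (k - j) + jap s j) := by
  have key : ∀ m : ℤ, 1 + (k : ℝ) ^ 2 ≤ 4 * (1 + (m : ℝ) ^ 2) →
      jap s k ≤ 2 ^ s * jap s m := by
    intro m hm
    have : (2 : ℝ) ^ s = 4 ^ (s / 2) := by
      rw [show (4 : ℝ) = 2 ^ (2 : ℝ) by norm_num, ← Real.rpow_mul (by norm_num)]
      congr 1; ring
    rw [this, jap, jap, ← Real.mul_rpow (by norm_num) (base_pos m).le]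
    exact Real.rpow_le_rpow (base_pos k).le hm (by positivity)
  have h2 : (0 : ℝ) ≤ 2 ^ s := by positivity
  rcases le_total ((j : ℝ) ^ 2) (((k - j : ℤ) : ℝ) ^ 2) with h | h
  · refine (key (k - j) ?_).trans (mul_le_mul_of_nonneg_left
      (le_add_of_nonneg_right (jap_pos _ _).le) h2)
    push_cast at h ⊢; nlinarith [sq_nonneg ((k : ℝ) - j - j)]
  · refine (key j ?_).trans (mul_le_mul_of_nonneg_left
      (le_add_of_nonneg_left (jap_pos _ _).le) h2)
    push_cast at h ⊢; nlinarith [sq_nonneg ((k : ℝ) - j - j)]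

lemma summable_jap_neg_two : Summable (fun k : ℤ => jap (-2) k) := by
  have h : ∀ k : ℤ, jap (-2) k = 1 / (1 + (k : ℝ) ^ 2) := by
    intro k; rw [eq_div_iff (base_pos k).ne', ← jap_two, jap_neg_mul]
  simp_rw [h]
  have h1 : Summable (fun k : ℤ => 1 / (k : ℝ) ^ 2) :=
    Real.summable_one_div_int_pow.mpr (by norm_num)
  refine Summable.of_norm_bounded_eventually h1 ?_
  have : ∀ᶠ k : ℤ in cofinite, k ≠ 0 := by
    simpa using (Set.finite_singleton (0 : ℤ)).compl_mem_cofinite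
  filter_upwards [this] with k hk
  have hk' : (0 : ℝ) < (k : ℝ) ^ 2 := by positivity
  rw [Real.norm_of_nonneg (by positivity)]
  exact one_div_le_one_div_of_le hk' (by linarith)

/-! ### Square summable sequences -/

lemma Seq.hasSum_sq (f : Seq) : HasSum (fun k => ‖f k‖ ^ 2) (‖f‖ ^ 2) := by
  have := lp.hasSum_norm (E := fun _ : ℤ => ℂ) (p := 2) (by norm_num) f
  simp only [ENNReal.toReal_ofNat, Real.rpow_ofNat] at this
  exact this

lemma Seq.summable_sq (f : Seq) : Summable (fun k => ‖f k‖ ^ 2) := f.hasSum_sq.summable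

lemma memSeq_iff {f : ℤ → ℂ} : Memℓp f 2 ↔ Summable (fun k => ‖f k‖ ^ 2) := by
  rw [memℓp_gen_iff (by norm_num)]; simp

lemma Seq.norm_apply_le (f : Seq) (k : ℤ) : ‖f k‖ ≤ ‖f‖ :=
  lp.norm_apply_le_norm (E := fun _ : ℤ => ℂ) (p := 2) (by norm_num) f k

lemma memSeq_of_le {F : ℤ → ℂ} (g : Seq) {C : ℝ} (h : ∀ k, ‖F k‖ ≤ C * ‖g k‖) :
    Memℓp F 2 := by
  rw [memSeq_iff]
  refine Summable.of_nonneg_of_le (fun k => by positivity) (fun k => ?_)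
    (g.summable_sq.mul_left (C ^ 2))
  rw [← mul_pow]
  exact pow_le_pow_left₀ (norm_nonneg _) (h k) 2

lemma Seq.norm_le_of_le {F g : Seq} {C : ℝ} (hC : 0 ≤ C) (h : ∀ k, ‖F k‖ ≤ C * ‖g k‖) :
    ‖F‖ ≤ C * ‖g‖ := by
  refine abs_le_of_sq_le_sq (a := ‖F‖) ?_ (by positivity) |> (le_abs_self _).trans
  rw [mul_pow, ← F.hasSum_sq.tsum_eq, ← g.hasSum_sq.tsum_eq, ← tsum_mul_left]
  refine F.summable_sq.tsum_le_tsum (fun k => ?_) (g.summable_sq.mul_left _)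
  rw [← mul_pow]
  exact pow_le_pow_left₀ (norm_nonneg _) (h k) 2

/-- The sequence of absolute values. -/
def Seq.abs (f : Seq) : Seq := Seq.mk (fun k => (‖f k‖ : ℂ)) (memSeq_of_le f (C := 1) (by simp))

@[simp] lemma Seq.abs_apply (f : Seq) (k : ℤ) : f.abs k = (‖f k‖ : ℂ) := rfl

lemma Seq.norm_abs (f : Seq) : ‖f.abs‖ = ‖f‖ := by
  apply le_antisymm
  · simpa using Seq.norm_le_of_le (F := f.abs) (g := f) zero_le_one (by simp)
  · simpa using Seq.norm_le_of_le (F := f) (g := f.abs) zero_le_one (by simp)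

/-- Translation of a sequence. -/
def Seq.shift (m : ℤ) (f : Seq) : Seq :=
  Seq.mk (fun k => f (k - m))
    (memSeq_iff.mpr ((Equiv.subRight m).summable_iff.mpr f.summable_sq))

@[simp] lemma Seq.shift_apply (m : ℤ) (f : Seq) (k : ℤ) : f.shift m k = f (k - m) := rfl

lemma Seq.norm_shift (m : ℤ) (f : Seq) : ‖f.shift m‖ = ‖f‖ := by
  have : ‖f.shift m‖ ^ 2 = ‖f‖ ^ 2 := by
    rw [← (f.shift m).hasSum_sq.tsum_eq, ← f.hasSum_sq.tsum_eq]
    exact (Equiv.subRight m).tsum_eq (fun k => ‖f k‖ ^ 2)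
  exact (pow_left_inj₀ (norm_nonneg _) (norm_nonneg _) two_ne_zero).mp this

/-- Reflection of a sequence. -/
def Seq.refl (f : Seq) : Seq :=
  Seq.mk (fun k => f (-k))
    (memSeq_iff.mpr ((Equiv.neg ℤ).summable_iff.mpr f.summable_sq))

lemma Seq.norm_refl (f : Seq) : ‖f.refl‖ = ‖f‖ := by
  have : ‖f.refl‖ ^ 2 = ‖f‖ ^ 2 := by
    rw [← f.refl.hasSum_sq.tsum_eq, ← f.hasSum_sq.tsum_eq]
    exact (Equiv.neg ℤ).tsum_eq (fun k => ‖f k‖ ^ 2)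
  exact (pow_left_inj₀ (norm_nonneg _) (norm_nonneg _) two_ne_zero).mp this

lemma Seq.summable_mul (f g : Seq) : Summable (fun k => ‖f k‖ * ‖g k‖) :=
  lp.summable_mul (E := fun _ : ℤ => ℂ) (p := 2) (q := 2)
    (by norm_num; exact Real.HolderConjugate.two_two) f g

lemma Seq.tsum_mul_le (f g : Seq) : ∑' k, ‖f k‖ * ‖g k‖ ≤ ‖f‖ * ‖g‖ :=
  lp.tsum_mul_le_mul_norm' (E := fun _ : ℤ => ℂ) (p := 2) (q := 2)
    (by norm_num; exact Real.HolderConjugate.two_two) f g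

/-! ### Convolution -/

/-- Convolution of sequences. -/
def conv (f g : ℤ → ℂ) (k : ℤ) : ℂ := ∑' j, f (k - j) * g j

lemma conv_comm (f g : ℤ → ℂ) : conv f g = conv g f := by
  funext k
  unfold conv
  rw [← (Equiv.subLeft k).tsum_eq]
  simp [mul_comm]

lemma Seq.summable_conv (f g : Seq) (k : ℤ) : Summable (fun j => ‖f (k - j)‖ * ‖g j‖) := by
  have := Seq.summable_mul (f.refl.shift k) g
  refine this.congr fun j => ?_
  simp [Seq.refl]

lemma Seq.tsum_conv_le (f g : Seq) (k : ℤ) :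
    ∑' j, ‖f (k - j)‖ * ‖g j‖ ≤ ‖f‖ * ‖g‖ := by
  have := Seq.tsum_mul_le (f.refl.shift k) g
  rw [Seq.norm_shift, Seq.norm_refl] at this
  refine le_trans (le_of_eq ?_) this
  exact tsum_congr fun j => by simp [Seq.refl]

lemma summable_conv_of_summable {b : ℤ → ℂ} (hb : Summable fun k => ‖b k‖) (f : Seq) (k : ℤ) :
    Summable (fun j => ‖b (k - j)‖ * ‖f j‖) := by
  refine Summable.of_nonneg_of_le (fun j => by positivity)
    (fun j => mul_le_mul_of_nonneg_left (f.norm_apply_le j) (norm_nonneg _)) ?_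
  exact ((Equiv.subLeft k).summable_iff.mpr hb).mul_right _

/-- Young's inequality `ℓ¹ * ℓ² ⊆ ℓ²`. -/
lemma exists_conv_of_summable {b : ℤ → ℂ} (hb : Summable fun k => ‖b k‖) (f : Seq) :
    ∃ g : Seq, (∀ k, g k = conv b f k) ∧ ‖g‖ ≤ (∑' k, ‖b k‖) * ‖f‖ := by
  -- The convolution is the series of the translates of f with coefficients b m. It converges
  -- absolutely in ℓ² because translations are isometric.
  have hn : ∀ m, ‖b m • f.shift m‖ = ‖b m‖ * ‖f‖ := fun m => by
    rw [norm_smul, Seq.norm_shift]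
  have hs : Summable (fun m => ‖b m • f.shift m‖) := by
    simp_rw [hn]; exact hb.mul_right _
  refine ⟨∑' m, b m • f.shift m, fun k => ?_, ?_⟩
  · have h1 := hs.of_norm.hasSum
    have h3 : HasSum (fun m => b m * f (k - m)) ((∑' m, b m • f.shift m : Seq) k) :=
      h1.map ((Pi.evalAddMonoidHom (fun _ : ℤ => ℂ) k).comp
        (lp.coeFnAddMonoidHom (fun _ : ℤ => ℂ) 2)) (Seq.continuous_eval k)
    rw [← h3.tsum_eq, conv_comm, conv]
    exact tsum_congr fun j => mul_comm _ _
  · refine (norm_tsum_le_tsum_norm hs).trans ?_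
    simp_rw [hn, tsum_mul_right]; exact le_rfl

/-- Multiplication of a sequence by the weight `(1 + k²)^(r/2)`. -/
def wt (r : ℝ) (f : ℤ → ℂ) (k : ℤ) : ℂ := (jap r k : ℂ) * f k

lemma norm_wt (r : ℝ) (f : ℤ → ℂ) (k : ℤ) : ‖wt r f k‖ = jap r k * ‖f k‖ := by
  rw [wt, norm_mul, Complex.norm_real, Real.norm_of_nonneg (jap_pos r k).le]

lemma wt_wt (r q : ℝ) (f : ℤ → ℂ) : wt r (wt q f) = wt (r + q) f := by
  funext k; simp only [wt, jap_add]; push_cast; ring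

lemma wt_zero (f : ℤ → ℂ) : wt 0 f = f := by
  funext k; simp [wt, jap_zero]

lemma wt_wt_neg (r : ℝ) (f : ℤ → ℂ) : wt r (wt (-r) f) = f := by
  rw [wt_wt, add_neg_cancel, wt_zero]

lemma wt_neg_wt (r : ℝ) (f : ℤ → ℂ) : wt (-r) (wt r f) = f := by
  rw [wt_wt, neg_add_cancel, wt_zero]

lemma wt_add (r : ℝ) (f g : ℤ → ℂ) : wt r (f + g) = wt r f + wt r g := by
  funext k; simp [wt, mul_add]

lemma wt_smul (r c : ℝ) (f : ℤ → ℂ) : wt r (c • f) = c • wt r f := by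
  funext k; simp [wt]; ring

/-- The convolution `f * g` converges absolutely at each point. -/
def ConvSummable (f g : ℤ → ℂ) : Prop := ∀ k, Summable fun j => ‖f (k - j)‖ * ‖g j‖

lemma ConvSummable.summable {f g : ℤ → ℂ} (h : ConvSummable f g) (k : ℤ) :
    Summable fun j => f (k - j) * g j :=
  Summable.of_norm (by simpa using h k)

lemma conv_add_right {b f g : ℤ → ℂ} (hf : ConvSummable b f) (hg : ConvSummable b g) :
    conv b (f + g) = conv b f + conv b g := by
  funext k
  simp only [conv, Pi.add_apply, mul_add]
  exact (hf.summable k).tsum_add (hg.summable k)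

lemma conv_smul_right (b f : ℤ → ℂ) (c : ℝ) : conv b (c • f) = c • conv b f := by
  funext k
  simp only [conv, Pi.smul_apply, Complex.real_smul, ← tsum_mul_left]
  exact tsum_congr fun j => by ring

lemma conv_add_left {b f g : ℤ → ℂ} (hf : ConvSummable f b) (hg : ConvSummable g b) :
    conv (f + g) b = conv f b + conv g b := by
  funext k
  simp only [conv, Pi.add_apply, add_mul]
  exact (hf.summable k).tsum_add (hg.summable k)

lemma conv_smul_left (b f : ℤ → ℂ) (c : ℝ) : conv (c • f) b = c • conv f b := by
  rw [conv_comm, conv_smul_right, conv_comm]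

/-- A bounded diagonal operator. -/
def diag (d : ℤ → ℂ) (hd : ∀ k, ‖d k‖ ≤ 1) : Seq →L[ℝ] Seq :=
  LinearMap.mkContinuous
    { toFun := fun f => Seq.mk (fun k => d k * f k) (memSeq_of_le f (C := 1) fun k => by
        rw [norm_mul]; exact mul_le_mul_of_nonneg_right (hd k) (norm_nonneg _))
      map_add' := fun f g => by
        apply Seq.ext; funext k
        exact mul_add _ _ _
      map_smul' := fun c f => by
        apply Seq.ext; funext k
        exact mul_smul_comm c (d k) (f k) } 1
    (fun f => Seq.norm_le_of_le zero_le_one fun k => by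
      change ‖d k * f k‖ ≤ _
      rw [norm_mul]; exact mul_le_mul_of_nonneg_right (hd k) (norm_nonneg _))

/-- The inverse weight `(1 - ∂²)^(-s/2)`, for `s ≥ 0`. -/
def smoothing (s : ℝ) (hs : 0 ≤ s) : Seq →L[ℝ] Seq :=
  diag (fun k => (jap (-s) k : ℂ)) fun k => by
    rw [Complex.norm_real, Real.norm_of_nonneg (jap_pos _ k).le]
    exact jap_le_one (by linarith) k

lemma coe_smoothing (s : ℝ) (hs : 0 ≤ s) (f : Seq) :
    (smoothing s hs f : ℤ → ℂ) = wt (-s) f := rfl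

lemma norm_smoothing_le (s : ℝ) (hs : 0 ≤ s) (f : Seq) : ‖smoothing s hs f‖ ≤ ‖f‖ := by
  refine (Seq.norm_le_of_le (C := 1) zero_le_one fun k => ?_).trans_eq (one_mul _)
  rw [coe_smoothing, norm_wt]
  exact mul_le_mul_of_nonneg_right (jap_le_one (by linarith) k) (norm_nonneg _)

/-! ### Multiplication by a smooth function -/

/-- Sequences with rapid decay, the Fourier coefficients of smooth functions. -/
def RapidDecay (b : ℤ → ℂ) : Prop := ∀ r : ℝ, Summable fun k => jap r k * ‖b k‖

lemma RapidDecay.summable_wt {b : ℤ → ℂ} (hb : RapidDecay b) (r : ℝ) :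
    Summable fun k => ‖wt r b k‖ := by simpa only [norm_wt] using hb r

/-- Peetre's inequality moves all the weight onto k - j, where the decay of b can pay for it; f is
left without weight. -/
lemma peetre_conv_le (b f : ℤ → ℂ) (r : ℝ) (k j : ℤ) :
    jap r k * (‖b (k - j)‖ * ‖wt (-r) f j‖)
      ≤ 2 ^ (|r| / 2) * (‖wt |r| b (k - j)‖ * ‖f j‖) := by
  rw [norm_wt, norm_wt]
  have h := jap_peetre r k j
  have h1 := mul_le_mul_of_nonneg_right h
    (show 0 ≤ ‖b (k - j)‖ * (jap (-r) j * ‖f j‖) by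
      have := (jap_pos (-r) j).le; positivity)
  refine h1.trans_eq ?_
  linear_combination (2 ^ (|r| / 2) * jap |r| (k - j) * ‖b (k - j)‖ * ‖f j‖) * jap_mul_neg r j

lemma convSummable_rapidDecay {b : ℤ → ℂ} (hb : RapidDecay b) (r : ℝ) (f : Seq) :
    ConvSummable b (wt (-r) f) := fun k => by
  have h1 := (summable_conv_of_summable (hb.summable_wt |r|) f k).mul_left
    ((jap r k)⁻¹ * 2 ^ (|r| / 2))
  refine Summable.of_nonneg_of_le (fun j => by positivity) (fun j => ?_) h1
  have := peetre_conv_le b f r k j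
  rw [mul_assoc, inv_mul_eq_div, le_div_iff₀ (jap_pos r k), mul_comm]
  exact this

/-- By `peetre_conv_le` the weighted convolution is dominated entrywise by that of an ℓ¹ sequence
with |f|, to which Young's inequality applies. -/
lemma exists_bound_wt_conv {b : ℤ → ℂ} (hb : RapidDecay b) (r : ℝ) (f : Seq) :
    ∃ g : Seq, ‖g‖ ≤ (∑' k, ‖wt |r| b k‖) * ‖f‖ ∧
      ∀ k, ‖wt r (conv b (wt (-r) f)) k‖ ≤ 2 ^ (|r| / 2) * ‖g k‖ := by
  obtain ⟨g, hg, hgn⟩ := exists_conv_of_summable (b := fun k => (‖wt |r| b k‖ : ℂ))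
    (by simpa using hb.summable_wt |r|) f.abs
  refine ⟨g, by simpa [Seq.norm_abs] using hgn, fun k => ?_⟩
  have hs1 := convSummable_rapidDecay hb r f k
  have hs2 := summable_conv_of_summable (hb.summable_wt |r|) f k
  have hgk : ‖g k‖ = ∑' j, ‖wt |r| b (k - j)‖ * ‖f j‖ := by
    rw [hg, conv]
    have : ∀ j, ((‖wt |r| b (k - j)‖ : ℝ) : ℂ) * f.abs j
        = ((‖wt |r| b (k - j)‖ * ‖f j‖ : ℝ) : ℂ) := fun j => by simp
    simp_rw [this]
    rw [← Complex.ofReal_tsum, Complex.norm_real, Real.norm_of_nonneg]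
    exact tsum_nonneg fun j => by positivity
  rw [norm_wt, hgk]
  calc jap r k * ‖conv b (wt (-r) f) k‖
      ≤ jap r k * ∑' j, ‖b (k - j)‖ * ‖wt (-r) f j‖ := by
        refine mul_le_mul_of_nonneg_left ?_ (jap_pos r k).le
        refine (norm_tsum_le_tsum_norm (by simpa using hs1)).trans_eq (by simp)
    _ = ∑' j, jap r k * (‖b (k - j)‖ * ‖wt (-r) f j‖) := by rw [tsum_mul_left]
    _ ≤ ∑' j, 2 ^ (|r| / 2) * (‖wt |r| b (k - j)‖ * ‖f j‖) :=
        (hs1.mul_left _).tsum_le_tsum (fun j => peetre_conv_le b f r k j) (hs2.mul_left _)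
    _ = _ := by rw [tsum_mul_left]

/-- Multiplication by a smooth function with Fourier coefficients `b`, conjugated with the weight
of order `r`. -/
def mulOp {b : ℤ → ℂ} (hb : RapidDecay b) (r : ℝ) : Seq →L[ℝ] Seq :=
  LinearMap.mkContinuous
    { toFun := fun f => Seq.mk (wt r (conv b (wt (-r) f))) (by
        obtain ⟨g, -, h⟩ := exists_bound_wt_conv hb r f
        exact memSeq_of_le g h)
      map_add' := fun f g => by
        apply Seq.ext
        change wt r (conv b (wt (-r) ((f : ℤ → ℂ) + g))) =
          wt r (conv b (wt (-r) f)) + wt r (conv b (wt (-r) g))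
        rw [wt_add, conv_add_right (convSummable_rapidDecay hb r f)
          (convSummable_rapidDecay hb r g), wt_add]
      map_smul' := fun c f => by
        apply Seq.ext
        change wt r (conv b (wt (-r) (c • (f : ℤ → ℂ)))) = c • wt r (conv b (wt (-r) f))
        rw [wt_smul, conv_smul_right, wt_smul] }
    (2 ^ (|r| / 2) * ∑' k, ‖wt |r| b k‖)
    (fun f => by
      obtain ⟨g, hg, h⟩ := exists_bound_wt_conv hb r f
      rw [mul_assoc]
      refine (Seq.norm_le_of_le (g := g) (by positivity) h).trans ?_
      exact mul_le_mul_of_nonneg_left hg (by positivity))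

lemma coe_mulOp {b : ℤ → ℂ} (hb : RapidDecay b) (r : ℝ) (f : Seq) :
    (mulOp hb r f : ℤ → ℂ) = wt r (conv b (wt (-r) f)) := rfl

/-- The damping operator `(1 - ∂²)⁻¹ a (1 - ∂²) a` on sequences of Fourier coefficients. -/
def dampSeq (b u : ℤ → ℂ) : ℤ → ℂ := wt (-2) (conv b (wt 2 (conv b u)))

/-- The damping operator, conjugated with the weight of order `s`. -/
def damp {b : ℤ → ℂ} (hb : RapidDecay b) (s : ℝ) : Seq →L[ℝ] Seq :=
  -- The operator 1 - ∂² between the two multiplications costs two derivatives, so it becomes the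
  -- identity if the outer factor is conjugated at order s - 2.
  (mulOp hb (s - 2)).comp (mulOp hb s)

lemma coe_damp {b : ℤ → ℂ} (hb : RapidDecay b) (s : ℝ) (f : Seq) :
    (damp hb s f : ℤ → ℂ) = wt s (dampSeq b (wt (-s) f)) := by
  change wt (s - 2) (conv b (wt (-(s - 2)) (wt s (conv b (wt (-s) f))))) = _
  rw [wt_wt, dampSeq, wt_wt, show -(s - 2) + s = 2 by ring, sub_eq_add_neg]

lemma smoothing_damp {b : ℤ → ℂ} (hb : RapidDecay b) (s : ℝ) (hs : 0 ≤ s) (f : Seq) :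
    smoothing s hs (damp hb s f) = damp hb 0 (smoothing s hs f) := by
  apply Seq.ext
  rw [coe_smoothing, coe_damp, coe_damp, coe_smoothing, wt_neg_wt, neg_zero, wt_zero, wt_zero]

/-! ### The quadratic term -/

/-- The Fourier multiplier of `-(1 - ∂²)⁻¹ ∂ / 2`. -/
def quadSymbol (k : ℤ) : ℂ := -(Complex.I * k / 2) * (jap (-2) k : ℂ)

/-- The bilinear form `-(1 - ∂²)⁻¹ ∂ (f g) / 2` on sequences of Fourier coefficients. -/
def quadSeq (f g : ℤ → ℂ) (k : ℤ) : ℂ := quadSymbol k * conv f g k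

lemma norm_quadSymbol_le (k : ℤ) : ‖quadSymbol k‖ ≤ jap (-1) k := by
  have h : jap (-1) k = jap 1 k * jap (-2) k := by rw [← jap_add]; norm_num
  rw [quadSymbol, norm_mul, Complex.norm_real, Real.norm_of_nonneg (jap_pos _ k).le, h]
  refine mul_le_mul_of_nonneg_right ?_ (jap_pos _ k).le
  have : ‖-(Complex.I * (k : ℂ) / 2)‖ = |(k : ℝ)| / 2 := by simp
  rw [this]
  have := abs_le_jap_one k
  have := abs_nonneg (k : ℝ)
  linarith

/-- The sequence `(1 + k²)^(-1/2)`. -/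
def invJap : Seq := Seq.mk (fun k => (jap (-1) k : ℂ)) (memSeq_iff.mpr (by
  have h : ∀ k : ℤ, ‖((jap (-1) k : ℝ) : ℂ)‖ ^ 2 = jap (-2) k := fun k => by
    rw [Complex.norm_real, Real.norm_of_nonneg (jap_pos _ k).le, sq, ← jap_add]; norm_num
  simp_rw [h]; exact summable_jap_neg_two))

lemma norm_invJap_apply (k : ℤ) : ‖invJap k‖ = jap (-1) k := by
  change ‖((jap (-1) k : ℝ) : ℂ)‖ = _
  rw [Complex.norm_real, Real.norm_of_nonneg (jap_pos _ k).le]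

/-- Elements of `H¹` have absolutely summable Fourier coefficients. -/
lemma Seq.summable_wt_neg_one (f : Seq) : Summable fun k => ‖wt (-1) f k‖ := by
  refine (Seq.summable_mul invJap f).congr fun k => ?_
  rw [norm_wt, norm_invJap_apply]

lemma Seq.tsum_wt_neg_one_le (f : Seq) : ∑' k, ‖wt (-1) f k‖ ≤ ‖invJap‖ * ‖f‖ := by
  refine le_trans (le_of_eq (tsum_congr fun k => ?_)) (Seq.tsum_mul_le invJap f)
  rw [norm_wt, norm_invJap_apply]

/-- The weight falls on one factor at a time (`jap_subadd`), and Cauchy–Schwarz bounds each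
convolution uniformly in k. Each term is an H^s norm times an L² norm, which makes the later growth
estimate linear in the H^s norm. -/
lemma wt_conv_le {s : ℝ} (hs : 0 ≤ s) (f g : Seq) (k : ℤ) :
    jap s k * ‖conv (wt (-s) f) (wt (-s) g) k‖
      ≤ 2 ^ s * (‖f‖ * ‖smoothing s hs g‖ + ‖smoothing s hs f‖ * ‖g‖) := by
  set F := smoothing s hs f with hF
  set G := smoothing s hs g with hG
  have hF' : wt (-s) f = F := rfl
  have hG' : wt (-s) g = G := rfl
  rw [hF', hG']
  have hFj : ∀ j, jap s j * ‖F j‖ = ‖f j‖ := fun j => by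
    rw [← hF', norm_wt, ← mul_assoc, jap_mul_neg, one_mul]
  have hGj : ∀ j, jap s j * ‖G j‖ = ‖g j‖ := fun j => by
    rw [← hG', norm_wt, ← mul_assoc, jap_mul_neg, one_mul]
  calc jap s k * ‖conv F G k‖
      ≤ jap s k * ∑' j, ‖F (k - j)‖ * ‖G j‖ := by
        refine mul_le_mul_of_nonneg_left ?_ (jap_pos s k).le
        refine (norm_tsum_le_tsum_norm (by simpa using F.summable_conv G k)).trans_eq (by simp)
    _ = ∑' j, jap s k * (‖F (k - j)‖ * ‖G j‖) := by rw [tsum_mul_left]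
    _ ≤ ∑' j, 2 ^ s * (‖f (k - j)‖ * ‖G j‖ + ‖F (k - j)‖ * ‖g j‖) := by
        refine ((F.summable_conv G k).mul_left _).tsum_le_tsum (fun j => ?_)
          (((f.summable_conv G k).add (F.summable_conv g k)).mul_left _)
        rw [← hFj, ← hGj]
        refine (mul_le_mul_of_nonneg_right (jap_subadd hs k j) (by positivity)).trans_eq ?_
        ring
    _ = 2 ^ s * (∑' j, ‖f (k - j)‖ * ‖G j‖ + ∑' j, ‖F (k - j)‖ * ‖g j‖) := by
        rw [tsum_mul_left, (f.summable_conv G k).tsum_add (F.summable_conv g k)]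
    _ ≤ _ := mul_le_mul_of_nonneg_left
        (add_le_add (f.tsum_conv_le G k) (F.tsum_conv_le g k)) (by positivity)

/-- The uniform bound of `wt_conv_le` becomes an ℓ² bound because the multiplier, of order -1, is
square summable in dimension one. -/
lemma wt_quadSeq_le {s : ℝ} (hs : 0 ≤ s) (f g : Seq) (k : ℤ) :
    ‖wt s (quadSeq (wt (-s) f) (wt (-s) g)) k‖
      ≤ (2 ^ s * (‖f‖ * ‖smoothing s hs g‖ + ‖smoothing s hs f‖ * ‖g‖)) * ‖invJap k‖ := by
  rw [norm_wt, quadSeq, norm_mul, norm_invJap_apply, mul_left_comm, mul_comm]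
  exact mul_le_mul (wt_conv_le hs f g k) (norm_quadSymbol_le k) (norm_nonneg _) (by positivity)

lemma convSummable_smoothing {s : ℝ} (hs : 0 ≤ s) (f g : Seq) :
    ConvSummable (wt (-s) f) (wt (-s) g) :=
  fun k => (smoothing s hs f).summable_conv (smoothing s hs g) k

lemma quadSeq_add_left {b f g : ℤ → ℂ} (hf : ConvSummable f b) (hg : ConvSummable g b) :
    quadSeq (f + g) b = quadSeq f b + quadSeq g b := by
  funext k; simp only [quadSeq, conv_add_left hf hg, Pi.add_apply, mul_add]

lemma quadSeq_add_right {b f g : ℤ → ℂ} (hf : ConvSummable b f) (hg : ConvSummable b g) :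
    quadSeq b (f + g) = quadSeq b f + quadSeq b g := by
  funext k; simp only [quadSeq, conv_add_right hf hg, Pi.add_apply, mul_add]

lemma quadSeq_smul_left (c : ℝ) (f g : ℤ → ℂ) : quadSeq (c • f) g = c • quadSeq f g := by
  funext k; simp only [quadSeq, conv_smul_left, Pi.smul_apply, Complex.real_smul]; ring

lemma quadSeq_smul_right (c : ℝ) (f g : ℤ → ℂ) : quadSeq f (c • g) = c • quadSeq f g := by
  funext k; simp only [quadSeq, conv_smul_right, Pi.smul_apply, Complex.real_smul]; ring

lemma quadSeq_comm (f g : ℤ → ℂ) : quadSeq f g = quadSeq g f := by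
  funext k; rw [quadSeq, quadSeq, conv_comm]

/-- The bilinear term, conjugated with the weight of order `s`. -/
def quad (s : ℝ) (hs : 0 ≤ s) : Seq →L[ℝ] Seq →L[ℝ] Seq :=
  LinearMap.mkContinuous₂
    (LinearMap.mk₂ ℝ (fun f g : Seq => Seq.mk (wt s (quadSeq (wt (-s) f) (wt (-s) g)))
        (memSeq_of_le invJap (wt_quadSeq_le hs f g)))
      (fun f f' g => by
        apply Seq.ext
        change wt s (quadSeq (wt (-s) ((f : ℤ → ℂ) + f')) (wt (-s) g)) = wt s _ + wt s _
        rw [wt_add, quadSeq_add_left (convSummable_smoothing hs f g)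
          (convSummable_smoothing hs f' g), wt_add])
      (fun c f g => by
        apply Seq.ext
        change wt s (quadSeq (wt (-s) (c • (f : ℤ → ℂ))) (wt (-s) g)) = c • wt s _
        rw [wt_smul, quadSeq_smul_left, wt_smul])
      (fun f g g' => by
        apply Seq.ext
        change wt s (quadSeq (wt (-s) f) (wt (-s) ((g : ℤ → ℂ) + g'))) = wt s _ + wt s _
        rw [wt_add, quadSeq_add_right (convSummable_smoothing hs f g)
          (convSummable_smoothing hs f g'), wt_add])
      (fun c f g => by
        apply Seq.ext
        change wt s (quadSeq (wt (-s) f) (wt (-s) (c • (g : ℤ → ℂ)))) = c • wt s _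
        rw [wt_smul, quadSeq_smul_right, wt_smul]))
    (2 ^ s * 2 * ‖invJap‖)
    (fun f g => by
      refine (Seq.norm_le_of_le (g := invJap) (by positivity) (wt_quadSeq_le hs f g)).trans ?_
      have h1 := mul_le_mul_of_nonneg_left (norm_smoothing_le s hs g) (norm_nonneg f)
      have h2 := mul_le_mul_of_nonneg_right (norm_smoothing_le s hs f) (norm_nonneg g)
      calc 2 ^ s * (‖f‖ * ‖smoothing s hs g‖ + ‖smoothing s hs f‖ * ‖g‖) * ‖invJap‖
          ≤ 2 ^ s * (‖f‖ * ‖g‖ + ‖f‖ * ‖g‖) * ‖invJap‖ := by gcongr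
        _ = _ := by ring)

lemma coe_quad (s : ℝ) (hs : 0 ≤ s) (f g : Seq) :
    (quad s hs f g : ℤ → ℂ) = wt s (quadSeq (wt (-s) f) (wt (-s) g)) := rfl

/-- The tame estimate for the bilinear term. -/
lemma norm_quad_le (s : ℝ) (hs : 0 ≤ s) (f g : Seq) :
    ‖quad s hs f g‖
      ≤ 2 ^ s * (‖f‖ * ‖smoothing s hs g‖ + ‖smoothing s hs f‖ * ‖g‖) * ‖invJap‖ :=
  Seq.norm_le_of_le (g := invJap) (by positivity) (wt_quadSeq_le hs f g)

lemma smoothing_quad (s : ℝ) (hs : 0 ≤ s) (f g : Seq) :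
    smoothing s hs (quad s hs f g) = quad 0 le_rfl (smoothing s hs f) (smoothing s hs g) := by
  apply Seq.ext
  rw [coe_smoothing, coe_quad, coe_quad, coe_smoothing, coe_smoothing, wt_neg_wt, neg_zero,
    wt_zero, wt_zero, wt_zero]

lemma quad_comm (s : ℝ) (hs : 0 ≤ s) (f g : Seq) : quad s hs f g = quad s hs g f := by
  apply Seq.ext
  rw [coe_quad, coe_quad, quadSeq_comm]

/-! ### The product of an `L²` and an `H¹` function -/

/-- An H¹ function has coefficients in ℓ¹, so its product with an L² function stays in L² by Young's
inequality; the multiplier of order -1 then gains one derivative. -/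
lemma exists_bound_wt_one_quadSeq (v g : Seq) :
    ∃ h : Seq, ‖h‖ ≤ ‖invJap‖ * ‖g‖ * ‖v‖ ∧
      ∀ k, ‖wt 1 (quadSeq v (wt (-1) g)) k‖ ≤ 1 * ‖h k‖ := by
  obtain ⟨h, hh, hn⟩ := exists_conv_of_summable g.summable_wt_neg_one v
  refine ⟨h, hn.trans (mul_le_mul_of_nonneg_right g.tsum_wt_neg_one_le (norm_nonneg _)),
    fun k => ?_⟩
  rw [norm_wt, quadSeq, norm_mul, conv_comm, hh, ← mul_assoc]
  refine mul_le_mul_of_nonneg_right ?_ (norm_nonneg _)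
  refine (mul_le_mul_of_nonneg_left (norm_quadSymbol_le k) (jap_pos 1 k).le).trans_eq ?_
  rw [jap_mul_neg]

/-- The bilinear term as a map `L² × H¹ → H¹`. -/
def mixedQuad : Seq →L[ℝ] Seq →L[ℝ] Seq :=
  have hcs : ∀ v g : Seq, ConvSummable v (wt (-1) g) := fun v g k => by
    have := v.summable_conv (smoothing 1 zero_le_one g) k
    exact this
  LinearMap.mkContinuous₂
    (LinearMap.mk₂ ℝ (fun v g : Seq => Seq.mk (wt 1 (quadSeq v (wt (-1) g))) (by
        obtain ⟨h, -, hh⟩ := exists_bound_wt_one_quadSeq v g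
        exact memSeq_of_le h hh))
      (fun v v' g => by
        apply Seq.ext
        change wt 1 (quadSeq ((v : ℤ → ℂ) + v') (wt (-1) g)) = wt 1 _ + wt 1 _
        rw [quadSeq_add_left (hcs v g) (hcs v' g), wt_add])
      (fun c v g => by
        apply Seq.ext
        change wt 1 (quadSeq (c • (v : ℤ → ℂ)) (wt (-1) g)) = c • wt 1 _
        rw [quadSeq_smul_left, wt_smul])
      (fun v g g' => by
        apply Seq.ext
        change wt 1 (quadSeq v (wt (-1) ((g : ℤ → ℂ) + g'))) = wt 1 _ + wt 1 _
        rw [wt_add, quadSeq_add_right (hcs v g) (hcs v g'), wt_add])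
      (fun c v g => by
        apply Seq.ext
        change wt 1 (quadSeq v (wt (-1) (c • (g : ℤ → ℂ)))) = c • wt 1 _
        rw [wt_smul, quadSeq_smul_right, wt_smul]))
    ‖invJap‖
    (fun v g => by
      obtain ⟨h, hn, hh⟩ := exists_bound_wt_one_quadSeq v g
      refine le_trans (Seq.norm_le_of_le (g := h) zero_le_one hh) ?_
      rw [one_mul]
      exact hn.trans_eq (by ring))

lemma coe_mixedQuad (v g : Seq) :
    (mixedQuad v g : ℤ → ℂ) = wt 1 (quadSeq v (wt (-1) g)) := rfl

lemma smoothing_mixedQuad (v g : Seq) :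
    smoothing 1 zero_le_one (mixedQuad v g) = quad 0 le_rfl v (smoothing 1 zero_le_one g) := by
  apply Seq.ext
  rw [coe_smoothing, coe_mixedQuad, coe_quad, coe_smoothing, wt_neg_wt, neg_zero,
    wt_zero, wt_zero, wt_zero]

/-! ### Ordinary differential equations in Banach spaces -/

section ODE

variable {E : Type*} [NormedAddCommGroup E]

/-- The coefficient of the radial projection to the ball of radius `R`. -/
def cutoff (R : ℝ) (x : E) : ℝ := R / max R ‖x‖

lemma cutoff_nonneg {R : ℝ} (hR : 0 < R) (x : E) : 0 ≤ cutoff R x := by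
  have : 0 < max R ‖x‖ := lt_max_of_lt_left hR
  unfold cutoff; positivity

lemma cutoff_le_one {R : ℝ} (hR : 0 < R) (x : E) : cutoff R x ≤ 1 :=
  (div_le_one (lt_max_of_lt_left hR)).mpr (le_max_left _ _)

lemma cutoff_eq_one {R : ℝ} (hR : 0 < R) {x : E} (hx : ‖x‖ ≤ R) : cutoff R x = 1 := by
  rw [cutoff, max_eq_left hx, div_self hR.ne']

lemma continuous_cutoff {R : ℝ} (hR : 0 < R) : Continuous (cutoff R : E → ℝ) :=
  continuous_const.div (continuous_const.max continuous_norm)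
    fun _ => (lt_max_of_lt_left hR).ne'

lemma exists_bound_of_continuousOn {y : ℝ → E} {T : ℝ} (h : ContinuousOn y (Set.Icc 0 T)) :
    ∃ R, 0 < R ∧ ∀ t ∈ Set.Icc 0 T, ‖y t‖ ≤ R := by
  obtain ⟨R, hR⟩ := isCompact_Icc.exists_bound_of_continuousOn h
  exact ⟨max R 1, by positivity, fun t ht => (hR t ht).trans (le_max_left _ _)⟩

variable [NormedSpace ℝ E]

lemma norm_cutoff_smul_le {R : ℝ} (hR : 0 < R) (x : E) : ‖cutoff R x • x‖ ≤ R := by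
  have h : 0 < max R ‖x‖ := lt_max_of_lt_left hR
  rw [norm_smul, Real.norm_of_nonneg (cutoff_nonneg hR x), cutoff, div_mul_eq_mul_div,
    div_le_iff₀ h]
  exact mul_le_mul_of_nonneg_left (le_max_right _ _) hR.le

/-- The increment splits into one from the change of x at a fixed factor and one from the change of
the factor; each is at most ‖x - y‖. -/
lemma lipschitzWith_cutoff_smul {R : ℝ} (hR : 0 < R) :
    LipschitzWith 2 (fun x : E => cutoff R x • x) := by
  refine LipschitzWith.of_dist_le_mul fun x y => ?_
  rw [dist_eq_norm, dist_eq_norm]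
  have hx : 0 < max R ‖x‖ := lt_max_of_lt_left hR
  have hy : 0 < max R ‖y‖ := lt_max_of_lt_left hR
  have hd : cutoff R x • x - cutoff R y • y
      = cutoff R x • (x - y) + (cutoff R x - cutoff R y) • y := by
    simp only [smul_sub, sub_smul]; abel
  have h1 : ‖cutoff R x • (x - y)‖ ≤ ‖x - y‖ := by
    rw [norm_smul, Real.norm_of_nonneg (cutoff_nonneg hR x)]
    exact mul_le_of_le_one_left (norm_nonneg _) (cutoff_le_one hR x)
  have hmax : |max R ‖y‖ - max R ‖x‖| ≤ ‖x - y‖ := by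
    rw [max_comm R, max_comm R, norm_sub_rev]
    exact (abs_max_sub_max_le_abs _ _ _).trans (abs_norm_sub_norm_le y x)
  have h2 : ‖(cutoff R x - cutoff R y) • y‖ ≤ ‖x - y‖ := by
    have he : cutoff R x - cutoff R y
        = cutoff R x * ((max R ‖y‖ - max R ‖x‖) / max R ‖y‖) := by
      unfold cutoff; field_simp
    rw [norm_smul, he, norm_mul, Real.norm_of_nonneg (cutoff_nonneg hR x), norm_div,
      Real.norm_of_nonneg hy.le, Real.norm_eq_abs, mul_assoc, div_mul_eq_mul_div]
    have h3 : |max R ‖y‖ - max R ‖x‖| * ‖y‖ / max R ‖y‖ ≤ ‖x - y‖ := by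
      rw [div_le_iff₀ hy]
      exact mul_le_mul hmax (le_max_right _ _) (norm_nonneg _) (norm_nonneg _)
    exact (mul_le_of_le_one_left (by positivity) (cutoff_le_one hR x)).trans h3
  rw [hd]
  calc _ ≤ _ := norm_add_le _ _
    _ ≤ ‖x - y‖ + ‖x - y‖ := add_le_add h1 h2
    _ = _ := by push_cast; ring

/-- `y` solves `y' = f(t, y)` on `[0, T]`. -/
def SolvesODE (f : ℝ → E → E) (T : ℝ) (y : ℝ → E) : Prop :=
  ∀ t ∈ Set.Icc 0 T, HasDerivWithinAt y (f t (y t)) (Set.Icc 0 T) t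

/-- The vector field is Lipschitz on bounded sets, uniformly in time, and continuous in time. -/
structure IsRegularField (f : ℝ → E → E) (T : ℝ) : Prop where
  lipschitz : ∀ R : ℝ, ∃ K : NNReal, ∀ t ∈ Set.Icc 0 T,
    LipschitzOnWith K (f t) (Metric.closedBall 0 R)
  continuousOn : ∀ x, ContinuousOn (fun t => f t x) (Set.Icc 0 T)

lemma SolvesODE.continuousOn {f : ℝ → E → E} {T : ℝ} {y : ℝ → E} (h : SolvesODE f T y) :
    ContinuousOn y (Set.Icc 0 T) := fun t ht => (h t ht).continuousWithinAt

lemma hasDerivWithinAt_Ici_of_Icc {y : ℝ → E} {y' : E} {T t : ℝ} (ht : t ∈ Set.Ico 0 T)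
    (h : HasDerivWithinAt y y' (Set.Icc 0 T) t) : HasDerivWithinAt y y' (Set.Ici t) t :=
  h.mono_of_mem_nhdsWithin
    (mem_of_superset (Icc_mem_nhdsGE ht.2) (Set.Icc_subset_Icc_left ht.1))

/-- Global solvability on `[0, T]`, under an a priori bound for the radially truncated
equations. -/
theorem exists_solvesODE_of_apriori [CompleteSpace E] {f : ℝ → E → E} {T : ℝ} (hT : 0 ≤ T)
    (hf : IsRegularField f T) {R : ℝ} (hR : 0 < R) (x₀ : E)
    (hap : ∀ (μ : ℝ → ℝ) (y : ℝ → E), ContinuousOn μ (Set.Icc 0 T) →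
      (∀ t, 0 ≤ μ t ∧ μ t ≤ 1 ∧ ‖μ t • y t‖ ≤ R) → y 0 = x₀ →
      SolvesODE (fun t x => f t (μ t • x)) T y → ∀ t ∈ Set.Icc 0 T, ‖y t‖ ≤ R) :
    ∃ y : ℝ → E, y 0 = x₀ ∧ (∀ t ∈ Set.Icc 0 T, ‖y t‖ ≤ R) ∧ SolvesODE f T y := by
  obtain ⟨K, hK⟩ := hf.lipschitz R
  obtain ⟨L₀, hL₀, hL⟩ := exists_bound_of_continuousOn (hf.continuousOn 0)
  -- L bounds the truncated field everywhere. With the radius L T no solution can leave the ball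
  -- before time T, so one application of Picard–Lindelöf reaches T.
  set L : NNReal := ⟨L₀ + K * R, by positivity⟩ with hLdef
  set a : NNReal := L * ⟨T, hT⟩ with ha
  have hpl : IsPicardLindelof (fun t x => f t (cutoff R x • x)) (tmin := 0) (tmax := T)
      ⟨0, le_rfl, hT⟩ x₀ a 0 L (K * 2) := by
    refine ⟨fun t ht => ?_, fun x _ => hf.continuousOn _, fun t ht x _ => ?_, ?_⟩
    · exact (hK t ht).comp (lipschitzWith_cutoff_smul hR).lipschitzOnWith
        (fun x _ => by simpa using norm_cutoff_smul_le hR x)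
    · have h1 := (hK t ht).dist_le_mul (cutoff R x • x)
        (by simpa using norm_cutoff_smul_le hR x) 0 (by simp [hR.le])
      rw [dist_eq_norm, dist_zero_right] at h1
      have h2 : ‖f t (cutoff R x • x)‖ ≤ ‖f t (cutoff R x • x) - f t 0‖ + ‖f t 0‖ := by
        simpa using norm_add_le (f t (cutoff R x • x) - f t 0) (f t 0)
      have h3 := mul_le_mul_of_nonneg_left (norm_cutoff_smul_le hR x) K.2
      change _ ≤ L₀ + K * R
      have := hL t ht
      have h4 : (K : ℝ) * ‖cutoff R x • x‖ ≤ K * R := h3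
      linarith
    · simp [ha, hT]
      exact le_rfl
  obtain ⟨y, hy0, hy⟩ := hpl.exists_eq_forall_mem_Icc_hasDerivWithinAt₀
  have hyc : ContinuousOn y (Set.Icc 0 T) := fun t ht => (hy t ht).continuousWithinAt
  -- Along the solution the truncation factor is a mere function of time, so the a priori bound
  -- applies; in turn it forces the factor to be 1.
  have hb : ∀ t ∈ Set.Icc 0 T, ‖y t‖ ≤ R :=
    hap (fun t => cutoff R (y t)) y ((continuous_cutoff hR).comp_continuousOn hyc)
      (fun t => ⟨cutoff_nonneg hR _, cutoff_le_one hR _, norm_cutoff_smul_le hR _⟩) hy0 hy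
  refine ⟨y, hy0, hb, fun t ht => ?_⟩
  have := hy t ht
  simpa only [cutoff_eq_one hR (hb t ht), one_smul] using this

/-- Global solvability within an invariant closed subspace. -/
theorem exists_solvesODE_mem_of_apriori [CompleteSpace E] (p : Submodule ℝ E)
    (hp : IsClosed (p : Set E)) {f : ℝ → E → E} {T : ℝ} (hT : 0 ≤ T)
    (hf : IsRegularField f T) (hfp : ∀ t, ∀ x ∈ p, f t x ∈ p) {R : ℝ} (hR : 0 < R)
    {x₀ : E} (hx₀ : x₀ ∈ p)
    (hap : ∀ (μ : ℝ → ℝ) (y : ℝ → E), ContinuousOn μ (Set.Icc 0 T) →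
      (∀ t, 0 ≤ μ t ∧ μ t ≤ 1 ∧ ‖μ t • y t‖ ≤ R) → y 0 = x₀ → (∀ t, y t ∈ p) →
      SolvesODE (fun t x => f t (μ t • x)) T y → ∀ t ∈ Set.Icc 0 T, ‖y t‖ ≤ R) :
    ∃ y : ℝ → E, y 0 = x₀ ∧ (∀ t, y t ∈ p) ∧ (∀ t ∈ Set.Icc 0 T, ‖y t‖ ≤ R) ∧
      SolvesODE f T y := by
  have : CompleteSpace p := hp.completeSpace_coe
  have hfr : IsRegularField (fun t (x : p) => (⟨f t x, hfp t x x.2⟩ : p)) T := by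
    refine ⟨fun R => ?_, fun x => ?_⟩
    · obtain ⟨K, hK⟩ := hf.lipschitz R
      refine ⟨K, fun t ht x hx y hy => ?_⟩
      exact hK t ht (by simpa using hx) (by simpa using hy)
    · exact continuousOn_iff_continuous_domRestrict.mpr
        ((continuousOn_iff_continuous_domRestrict.mp (hf.continuousOn x)).subtype_mk _)
  obtain ⟨y, h0, hb, hy⟩ := exists_solvesODE_of_apriori hT hfr hR ⟨x₀, hx₀⟩
    (fun μ y hμ hμy hy0 hy => hap μ (fun t => y t) hμ (fun t => hμy t)
      (congrArg Subtype.val hy0) (fun t => (y t).2)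
      (fun t ht => p.subtypeL.hasFDerivAt.comp_hasDerivWithinAt t (hy t ht)))
  exact ⟨fun t => y t, congrArg Subtype.val h0, fun t => (y t).2, hb,
    fun t ht => p.subtypeL.hasFDerivAt.comp_hasDerivWithinAt t (hy t ht)⟩

lemma SolvesODE.eqOn {f : ℝ → E → E} {T : ℝ} (hf : IsRegularField f T) {y z : ℝ → E}
    (hy : SolvesODE f T y) (hz : SolvesODE f T z) (h0 : y 0 = z 0) :
    Set.EqOn y z (Set.Icc 0 T) := by
  obtain ⟨R, -, hR⟩ := exists_bound_of_continuousOn hy.continuousOn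
  obtain ⟨R', -, hR'⟩ := exists_bound_of_continuousOn hz.continuousOn
  obtain ⟨K, hK⟩ := hf.lipschitz (max R R')
  refine ODE_solution_unique_of_mem_Icc_right (v := f)
    (s := fun _ => Metric.closedBall 0 (max R R'))
    (fun t ht => hK t (Set.Ico_subset_Icc_self ht)) hy.continuousOn
    (fun t ht => hasDerivWithinAt_Ici_of_Icc ht (hy t (Set.Ico_subset_Icc_self ht)))
    (fun t ht => ?_) hz.continuousOn
    (fun t ht => hasDerivWithinAt_Ici_of_Icc ht (hz t (Set.Ico_subset_Icc_self ht)))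
    (fun t ht => ?_) h0
  · simpa using Or.inl (hR t (Set.Ico_subset_Icc_self ht))
  · simpa using Or.inr (hR' t (Set.Ico_subset_Icc_self ht))

lemma SolvesODE.norm_le {f : ℝ → E → E} {T : ℝ} {y : ℝ → E} (hy : SolvesODE f T y)
    {K : ℝ} (hK : 0 ≤ K) (h : ∀ t ∈ Set.Icc 0 T, ‖f t (y t)‖ ≤ K * ‖y t‖) :
    ∀ t ∈ Set.Icc 0 T, ‖y t‖ ≤ ‖y 0‖ * Real.exp (K * T) := by
  intro t ht
  have := norm_le_gronwallBound_of_norm_deriv_right_le (δ := ‖y 0‖) (K := K) (ε := 0)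
    hy.continuousOn
    (fun t ht => hasDerivWithinAt_Ici_of_Icc ht (hy t (Set.Ico_subset_Icc_self ht))) le_rfl
    (fun t ht => by simpa using h t (Set.Ico_subset_Icc_self ht)) t ht
  rw [sub_zero, gronwallBound_ε0] at this
  refine this.trans (mul_le_mul_of_nonneg_left ?_ (norm_nonneg _))
  exact Real.exp_le_exp.mpr (mul_le_mul_of_nonneg_left ht.2 hK)

/-- Energy estimate. -/
lemma SolvesODE.norm_le_of_inner {F : Type*} [NormedAddCommGroup F] [InnerProductSpace ℂ F]
    [NormedSpace ℝ F] {f : ℝ → F → F} {T : ℝ} {y : ℝ → F} (hy : SolvesODE f T y)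
    {K : ℝ} (hK : 0 ≤ K)
    (h : ∀ t ∈ Set.Icc 0 T, (inner ℂ (y t) (f t (y t))).re ≤ K * ‖y t‖ ^ 2) :
    ∀ t ∈ Set.Icc 0 T, ‖y t‖ ≤ ‖y 0‖ * Real.exp (K * T) := by
  intro t ht
  have hd : ∀ t ∈ Set.Icc 0 T, HasDerivWithinAt (fun t => ‖y t‖ ^ 2)
      (2 * (inner ℂ (y t) (f t (y t))).re) (Set.Icc 0 T) t := fun t ht => by
    have h1 := (hy t ht).inner ℂ (hy t ht)
    have h2 := Complex.reCLM.hasFDerivAt.comp_hasDerivWithinAt t h1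
    have h3 : (fun t => ‖y t‖ ^ 2) = Complex.reCLM ∘ fun t => inner ℂ (y t) (y t) := by
      funext t
      simp only [Function.comp_apply, Complex.reCLM_apply]
      exact (inner_self_eq_norm_sq (𝕜 := ℂ) (y t)).symm
    rw [h3]
    refine h2.congr_deriv ?_
    rw [Complex.reCLM_apply, Complex.add_re, two_mul]
    congr 1
    rw [← inner_conj_symm, Complex.conj_re]
  have := le_gronwallBound_of_liminf_deriv_right_le (f := fun t => ‖y t‖ ^ 2)
    (f' := fun t => 2 * (inner ℂ (y t) (f t (y t))).re)
    (δ := ‖y 0‖ ^ 2) (K := 2 * K) (ε := 0) (a := 0) (b := T)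
    (fun t ht => (hd t ht).continuousWithinAt)
    (fun t ht r hr => (hasDerivWithinAt_Ici_of_Icc ht
      (hd t (Set.Ico_subset_Icc_self ht))).liminf_right_slope_le hr) le_rfl
    (fun t ht => by have := h t (Set.Ico_subset_Icc_self ht); linarith) t ht
  rw [sub_zero, gronwallBound_ε0] at this
  refine abs_le_of_sq_le_sq (this.trans ?_) (by positivity) |> (le_abs_self _).trans
  rw [mul_pow, ← Real.exp_nat_mul]
  refine mul_le_mul_of_nonneg_left (Real.exp_le_exp.mpr ?_) (by positivity)
  have := mul_le_mul_of_nonneg_left ht.2 hK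
  push_cast; linarith

end ODE

/-! ### Sequences of Fourier coefficients of real functions -/

/-- The symmetry of the Fourier coefficients of real functions. -/
def IsReal (f : ℤ → ℂ) : Prop := ∀ k, f (-k) = conj (f k)

lemma IsReal.add {f g : ℤ → ℂ} (hf : IsReal f) (hg : IsReal g) : IsReal (f + g) := fun k => by
  simp [hf k, hg k]

lemma IsReal.smul {f : ℤ → ℂ} (hf : IsReal f) (c : ℝ) : IsReal (c • f) := fun k => by
  simp [hf k]

lemma IsReal.wt {f : ℤ → ℂ} (hf : IsReal f) (r : ℝ) : IsReal (wt r f) := fun k => by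
  simp [KdVBBM.wt, hf k, jap_neg_arg]

lemma IsReal.conv {f g : ℤ → ℂ} (hf : IsReal f) (hg : IsReal g) : IsReal (conv f g) :=
  fun k => by
  rw [KdVBBM.conv, KdVBBM.conv, ← Complex.conjCLE_apply, Complex.conjCLE.map_tsum,
    ← (Equiv.neg ℤ).tsum_eq]
  refine tsum_congr fun j => ?_
  rw [Equiv.neg_apply, hg j, show -k - -j = -(k - j) by ring, hf, Complex.conjCLE_apply, map_mul]

lemma IsReal.quadSeq {f g : ℤ → ℂ} (hf : IsReal f) (hg : IsReal g) : IsReal (quadSeq f g) :=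
  fun k => by
  rw [KdVBBM.quadSeq, KdVBBM.quadSeq, hf.conv hg, map_mul]
  congr 1
  simp [quadSymbol, jap_neg_arg, map_div₀, Complex.conj_ofNat]

lemma IsReal.dampSeq {b f : ℤ → ℂ} (hb : IsReal b) (hf : IsReal f) : IsReal (dampSeq b f) :=
  (hb.conv ((hb.conv hf).wt _)).wt _

/-- The real subspace of `Seq`. -/
def realSeq : Submodule ℝ Seq where
  carrier := {f | IsReal f}
  add_mem' := fun hf hg => IsReal.add hf hg
  zero_mem' := fun k => by simp
  smul_mem' := fun c _ hf => IsReal.smul hf c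

lemma mem_realSeq {f : Seq} : f ∈ realSeq ↔ IsReal f := Iff.rfl

lemma isClosed_realSeq : IsClosed (realSeq : Set Seq) := by
  have : (realSeq : Set Seq) = ⋂ k : ℤ, {f : Seq | f (-k) = conj (f k)} := by
    ext f; simp [mem_realSeq, IsReal]
  rw [this]
  exact isClosed_iInter fun k => isClosed_eq (Seq.continuous_eval _)
    (Complex.continuous_conj.comp (Seq.continuous_eval k))

/-! ### The unitary group of the linear part -/

/-- The phase `-k (c + 1 / (1 + k²))`. -/
def phase (c : ℝ) (k : ℤ) : ℝ := -(k * (c + 1 / (1 + (k : ℝ) ^ 2)))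

lemma phase_neg (c : ℝ) (k : ℤ) : phase c (-k) = -phase c k := by simp [phase]

/-- The group generated by `(1 - ∂²)⁻¹ (c ∂³ - (c + 1) ∂)`. -/
def evol (c t : ℝ) : Seq →L[ℝ] Seq :=
  diag (fun k => Complex.exp ((t * phase c k : ℝ) * Complex.I))
    fun _ => (Complex.norm_exp_ofReal_mul_I _).le

lemma evol_apply (c t : ℝ) (f : Seq) (k : ℤ) :
    evol c t f k = Complex.exp ((t * phase c k : ℝ) * Complex.I) * f k := rfl

lemma norm_evol_apply (c t : ℝ) (f : Seq) (k : ℤ) : ‖evol c t f k‖ = ‖f k‖ := by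
  rw [evol_apply, norm_mul, Complex.norm_exp_ofReal_mul_I, one_mul]

lemma norm_evol (c t : ℝ) (f : Seq) : ‖evol c t f‖ = ‖f‖ := by
  have : ‖evol c t f‖ ^ 2 = ‖f‖ ^ 2 := by
    rw [← (evol c t f).hasSum_sq.tsum_eq, ← f.hasSum_sq.tsum_eq]
    simp_rw [norm_evol_apply]
  exact (pow_left_inj₀ (norm_nonneg _) (norm_nonneg _) two_ne_zero).mp this

lemma evol_neg_evol (c t : ℝ) (f : Seq) : evol c (-t) (evol c t f) = f := by
  apply Seq.ext; funext k
  rw [evol_apply, evol_apply, ← mul_assoc, ← Complex.exp_add, ← add_mul, ← Complex.ofReal_add]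
  simp

lemma evol_evol_neg (c t : ℝ) (f : Seq) : evol c t (evol c (-t) f) = f := by
  simpa using evol_neg_evol c (-t) f

lemma evol_zero (c : ℝ) (f : Seq) : evol c 0 f = f := by
  apply Seq.ext; funext k; simp [evol_apply]

lemma smoothing_evol (s : ℝ) (hs : 0 ≤ s) (c t : ℝ) (f : Seq) :
    smoothing s hs (evol c t f) = evol c t (smoothing s hs f) := by
  apply Seq.ext; funext k
  exact mul_left_comm _ _ _

lemma inner_evol_neg (c t : ℝ) (f g : Seq) :
    inner ℂ f (evol c (-t) g) = inner ℂ (evol c t f) g := by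
  rw [Seq.inner_eq_tsum, Seq.inner_eq_tsum]
  refine tsum_congr fun k => ?_
  rw [evol_apply, evol_apply]
  simp only [RCLike.inner_apply, map_mul, ← Complex.exp_conj, Complex.conj_ofReal,
    Complex.conj_I]
  push_cast; simp only [mul_neg, neg_mul]; ring

/-- Only strong continuity is claimed, since the phases need not be bounded in k. It follows by
domination, the squares of the entries being at most 4‖f k‖². -/
lemma continuous_evol_apply (c : ℝ) (f : Seq) : Continuous (fun t => evol c t f) := by
  rw [continuous_iff_continuousAt]
  intro t₀
  rw [ContinuousAt, tendsto_iff_norm_sub_tendsto_zero]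
  have h : ∀ t, ‖evol c t f - evol c t₀ f‖ ^ 2
      = ∑' k, ‖evol c t f k - evol c t₀ f k‖ ^ 2 := fun t => by
    rw [← (evol c t f - evol c t₀ f).hasSum_sq.tsum_eq]; rfl
  have hc : Continuous fun t => ∑' k, ‖evol c t f k - evol c t₀ f k‖ ^ 2 := by
    refine continuous_tsum (u := fun k => 4 * ‖f k‖ ^ 2) (fun k => ?_)
      (f.summable_sq.mul_left 4) (fun k t => ?_)
    · simp only [evol_apply]; fun_prop
    · rw [Real.norm_of_nonneg (by positivity), show 4 * ‖f k‖ ^ 2 = (2 * ‖f k‖) ^ 2 by ring]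
      refine pow_le_pow_left₀ (norm_nonneg _) ((norm_sub_le _ _).trans_eq ?_) 2
      rw [norm_evol_apply, norm_evol_apply]; ring
  have h2 : Tendsto (fun t => Real.sqrt (‖evol c t f - evol c t₀ f‖ ^ 2)) (𝓝 t₀) (𝓝 0) := by
    simp_rw [h]
    have := (Real.continuous_sqrt.comp hc).tendsto t₀
    simpa [Function.comp_def] using this
  simpa using h2

/-- Strong continuity upgrades to joint continuity because the operators are isometries. -/
lemma continuous_evol (c : ℝ) : Continuous (fun p : ℝ × Seq => evol c p.1 p.2) := by
  rw [continuous_iff_continuousAt]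
  rintro ⟨t₀, f₀⟩
  rw [ContinuousAt, tendsto_iff_norm_sub_tendsto_zero]
  have h1 : Tendsto (fun p : ℝ × Seq => ‖p.2 - f₀‖ + ‖evol c p.1 f₀ - evol c t₀ f₀‖)
      (𝓝 (t₀, f₀)) (𝓝 0) := by
    have hc : Continuous
        (fun p : ℝ × Seq => ‖p.2 - f₀‖ + ‖evol c p.1 f₀ - evol c t₀ f₀‖) := by
      have := (continuous_evol_apply c f₀).comp (continuous_fst (X := ℝ) (Y := Seq))
      exact ((continuous_snd.sub continuous_const).norm).add (this.sub continuous_const).norm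
    simpa using hc.tendsto (t₀, f₀)
  refine squeeze_zero (fun _ => norm_nonneg _) (fun p => ?_) h1
  calc ‖evol c p.1 p.2 - evol c t₀ f₀‖
      = ‖evol c p.1 (p.2 - f₀) + (evol c p.1 f₀ - evol c t₀ f₀)‖ := by
        rw [map_sub]; congr 1; abel
    _ ≤ ‖evol c p.1 (p.2 - f₀)‖ + ‖evol c p.1 f₀ - evol c t₀ f₀‖ := norm_add_le _ _
    _ = _ := by rw [norm_evol]

lemma continuousOn_comp_prodMk {X Y Z : Type*} [TopologicalSpace X] [TopologicalSpace Y]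
    [TopologicalSpace Z] {g : X × Y → Z} (hg : Continuous g) {τ : ℝ → X} {x : ℝ → Y} {S : Set ℝ}
    (hτ : ContinuousOn τ S) (hx : ContinuousOn x S) :
    ContinuousOn (fun t => g (τ t, x t)) S :=
  hg.comp_continuousOn (hτ.prodMk hx)

lemma continuousOn_evol (c : ℝ) {τ : ℝ → ℝ} {x : ℝ → Seq} {S : Set ℝ} (hτ : ContinuousOn τ S)
    (hx : ContinuousOn x S) : ContinuousOn (fun t => evol c (τ t) (x t)) S :=
  continuousOn_comp_prodMk (g := fun p : ℝ × Seq => evol c p.1 p.2) (continuous_evol c) hτ hx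

lemma IsReal.evol {f : Seq} (hf : IsReal f) (c t : ℝ) : IsReal (evol c t f) := fun k => by
  rw [evol_apply, evol_apply, hf k, map_mul, ← Complex.exp_conj, map_mul, Complex.conj_ofReal,
    Complex.conj_I, phase_neg]
  push_cast; simp only [mul_neg, neg_mul]

/-! ### Cancellation in the cubic term -/

/-- `∫ w² w_x = 0`, for the Fourier coefficients of an `H¹` function. -/
lemma tsum_cubic_eq_zero (g : Seq) :
    ∑' k : ℤ, (k : ℂ) * wt (-1) g k * conv (wt (-1) g) (wt (-1) g) (-k) = 0 := by
  set w := wt (-1) g with hw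
  -- The sum runs over triples of frequencies with sum zero, the derivative falling on the first of
  -- them.
  set F : ℤ × ℤ → ℂ := fun p => p.1 * w p.1 * (w (-p.1 - p.2) * w p.2) with hF
  have hwk : ∀ k : ℤ, ‖(k : ℂ) * w k‖ ≤ ‖g k‖ := fun k => by
    rw [norm_mul, hw, norm_wt, Complex.norm_intCast, ← mul_assoc]
    refine mul_le_of_le_one_left (norm_nonneg _) ?_
    refine (mul_le_mul_of_nonneg_right (abs_le_jap_one k) (jap_pos _ _).le).trans_eq ?_
    rw [jap_mul_neg]
  have hwg : ∀ k : ℤ, ‖w k‖ ≤ ‖g k‖ := fun k => by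
    rw [hw, norm_wt]
    exact mul_le_of_le_one_left (norm_nonneg _) (jap_le_one (by norm_num) k)
  have hws : Summable fun k => ‖w k‖ := g.summable_wt_neg_one
  clear_value w
  -- Absolute convergence, needed for the relabellings: one factor w is in ℓ¹, while the other w and
  -- the differentiated factor are dominated by g in ℓ².
  have hG : Summable fun p : ℤ × ℤ => ‖w p.1‖ * (‖g (-p.1 - p.2)‖ * ‖g p.2‖) := by
    rw [summable_prod_of_nonneg fun p => by positivity]
    refine ⟨fun j => (g.summable_conv g (-j)).mul_left ‖w j‖, ?_⟩
    refine Summable.of_nonneg_of_le (fun j => tsum_nonneg fun k => by positivity) (fun j => ?_)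
      (hws.mul_right (‖g‖ * ‖g‖))
    calc _ = ‖w j‖ * ∑' k, ‖g (-j - k)‖ * ‖g k‖ := tsum_mul_left
      _ ≤ _ := mul_le_mul_of_nonneg_left (g.tsum_conv_le g (-j)) (norm_nonneg _)
  have hFs : Summable F := by
    refine Summable.of_norm_bounded ((Equiv.prodComm ℤ ℤ).summable_iff.mpr hG) fun p => ?_
    have h1 := hwk p.1
    have h2 := hwg (-p.1 - p.2)
    simp only [Function.comp_apply, Equiv.prodComm_apply, Prod.fst_swap, Prod.snd_swap]
    calc ‖F p‖ = ‖(p.1 : ℂ) * w p.1‖ * (‖w (-p.1 - p.2)‖ * ‖w p.2‖) := by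
          rw [hF, norm_mul, norm_mul (w _)]
      _ ≤ ‖g p.1‖ * (‖g (-p.1 - p.2)‖ * ‖w p.2‖) := by gcongr
      _ = _ := by rw [show -p.2 - p.1 = -p.1 - p.2 by ring]; ring
  have hS : ∑' k : ℤ, (k : ℂ) * w k * conv w w (-k) = ∑' p, F p := by
    rw [hFs.tsum_prod]
    refine tsum_congr fun k => ?_
    rw [conv, ← tsum_mul_left]
  have h1 : ∑' p : ℤ × ℤ, F p = ∑' p : ℤ × ℤ, F (p.2, p.1) :=
    ((Equiv.prodComm ℤ ℤ).tsum_eq F).symm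
  let e : ℤ × ℤ ≃ ℤ × ℤ :=
    { toFun := fun p => (-p.1 - p.2, p.2)
      invFun := fun p => (-p.1 - p.2, p.2)
      left_inv := fun p => by simp
      right_inv := fun p => by simp }
  have h2 : ∑' p : ℤ × ℤ, F p = ∑' p : ℤ × ℤ, F (-p.1 - p.2, p.2) := (e.tsum_eq F).symm
  have hF1 : Summable fun p : ℤ × ℤ => F (p.2, p.1) := (Equiv.prodComm ℤ ℤ).summable_iff.mpr hFs
  have hF2 : Summable fun p : ℤ × ℤ => F (-p.1 - p.2, p.2) := e.summable_iff.mpr hFs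
  -- The three relabellings put the derivative on each frequency in turn, and the frequencies add up
  -- to zero.
  have h3 : ∑' p : ℤ × ℤ, (F p + F (p.2, p.1) + F (-p.1 - p.2, p.2)) = 0 := by
    rw [← tsum_zero (α := ℂ) (β := ℤ × ℤ)]
    refine tsum_congr fun p => ?_
    simp only [hF]
    rw [show -p.2 - p.1 = -p.1 - p.2 by ring, show -(-p.1 - p.2) - p.2 = p.1 by ring]
    push_cast; ring
  rw [(hFs.add hF1).tsum_add hF2, hFs.tsum_add hF1, ← h1, ← h2] at h3
  rw [hS]
  linear_combination h3 / 3

/-- With w the function of weighted coefficients g, this is the H¹ product of w with -(1 -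
∂²)⁻¹∂(w²)/2, hence a multiple of ∫ w (w²)_x. The reflection k ↦ -k and the reality of g bring it to
the form of `tsum_cubic_eq_zero`. -/
lemma inner_quad_one_eq_zero {g : Seq} (hg : IsReal g) :
    inner ℂ g (quad 1 zero_le_one g g) = 0 := by
  rw [Seq.inner_eq_tsum, ← (Equiv.neg ℤ).tsum_eq]
  have h : ∀ k : ℤ, inner ℂ (g (-k)) (quad 1 zero_le_one g g (-k))
      = Complex.I / 2 * ((k : ℂ) * wt (-1) g k * conv (wt (-1) g) (wt (-1) g) (-k)) :=
    fun k => by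
    have h1 : (jap 1 k : ℂ) * (jap (-2) k : ℂ) = (jap (-1) k : ℂ) := by
      rw [← Complex.ofReal_mul, ← jap_add]; norm_num
    have h2 : (quad 1 zero_le_one g g (-k))
        = (jap 1 k : ℂ) * (Complex.I * k / 2 * (jap (-2) k : ℂ)
          * conv (wt (-1) g) (wt (-1) g) (-k)) := by
      rw [coe_quad, wt, quadSeq, quadSymbol, jap_neg_arg, jap_neg_arg]
      push_cast; ring
    rw [h2, RCLike.inner_apply, hg k, Complex.conj_conj, wt, ← h1]
    ring
  simp only [Equiv.neg_apply, h]
  rw [tsum_mul_left, tsum_cubic_eq_zero, mul_zero]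

/-! ### Quadratic equations in the interaction picture -/

lemma continuousOn_linear_add_quadratic {E : Type*} [NormedAddCommGroup E] [NormedSpace ℝ E]
    {A : ℝ → E →L[ℝ] E} (B : E →L[ℝ] E →L[ℝ] E) {β : ℝ → ℝ} {x : ℝ → E} {S : Set ℝ}
    (hA : ContinuousOn A S) (hβ : ContinuousOn β S) (hx : ContinuousOn x S) :
    ContinuousOn (fun t => A t (x t) + β t • B (x t) (x t)) S :=
  (hA.clm_apply hx).add (hβ.smul ((B.continuous.comp_continuousOn hx).clm_apply hx))

lemma continuousOn_neg_add_smul {E : Type*} [NormedAddCommGroup E] [NormedSpace ℝ E]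
    {α β : ℝ → ℝ} {x : ℝ → E} {S : Set ℝ} (L : E →L[ℝ] E) (B : E →L[ℝ] E →L[ℝ] E)
    (hα : ContinuousOn α S) (hβ : ContinuousOn β S) (hx : ContinuousOn x S) :
    ContinuousOn (fun t => -(α t • L) + β t • (2 : ℝ) • B (x t)) S :=
  (hα.smul continuousOn_const).neg.add
    (hβ.smul ((B.continuous.comp_continuousOn hx).const_smul (2 : ℝ)))

lemma norm_neg_add_smul_le {E : Type*} [NormedAddCommGroup E] [NormedSpace ℝ E]
    {α β : ℝ} {x : E} (L : E →L[ℝ] E) (B : E →L[ℝ] E →L[ℝ] E)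
    (hα : α ∈ Set.Icc (0 : ℝ) 1) (hβ : β ∈ Set.Icc (0 : ℝ) 1) (hx : ‖x‖ ≤ 1) :
    ‖-(α • L) + β • (2 : ℝ) • B x‖ ≤ ‖L‖ + 2 * ‖B‖ := by
  have h1 : ‖-(α • L)‖ ≤ ‖L‖ := by
    rw [norm_neg, norm_smul, Real.norm_of_nonneg hα.1]
    exact mul_le_of_le_one_left (norm_nonneg _) hα.2
  have h2 : ‖B x‖ ≤ ‖B‖ * 1 :=
    (B.le_opNorm _).trans (mul_le_mul_of_nonneg_left hx (norm_nonneg _))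
  have h3 : ‖β • (2 : ℝ) • B x‖ ≤ 2 * ‖B‖ := by
    rw [norm_smul, norm_smul, Real.norm_of_nonneg hβ.1, Real.norm_two]
    refine (mul_le_of_le_one_left (by positivity) hβ.2).trans ?_
    linarith
  exact (norm_add_le _ _).trans (add_le_add h1 h3)

/-- The vector field `x ↦ A(t) x + β(t) B(x, x)`, conjugated with the unitary group. -/
def field (c : ℝ) (A : ℝ → Seq →L[ℝ] Seq) (B : Seq →L[ℝ] Seq →L[ℝ] Seq) (β : ℝ → ℝ)
    (t : ℝ) (x : Seq) : Seq :=
  evol c (-t) (A t (evol c t x) + β t • B (evol c t x) (evol c t x))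

/-- As the group is isometric, the Lipschitz constants on balls are those of the unconjugated field.
Continuity in time is needed only at fixed x, which is what strong continuity of the group provides.
-/
lemma isRegularField_field (c : ℝ) {A : ℝ → Seq →L[ℝ] Seq} (B : Seq →L[ℝ] Seq →L[ℝ] Seq)
    {β : ℝ → ℝ} {T : ℝ} (hA : ContinuousOn A (Set.Icc 0 T)) (hβ : ContinuousOn β (Set.Icc 0 T)) :
    IsRegularField (field c A B β) T := by
  constructor
  · intro R
    obtain ⟨M, hM0, hM⟩ := exists_bound_of_continuousOn hA
    obtain ⟨N, hN0, hN⟩ := exists_bound_of_continuousOn hβ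
    refine ⟨⟨M + N * (‖B‖ * (2 * |R|)), by positivity⟩, fun t ht => ?_⟩
    refine LipschitzOnWith.of_dist_le_mul fun x hx y hy => ?_
    have hx' : ‖evol c t x‖ ≤ |R| := by
      rw [norm_evol]; exact (by simpa using hx : ‖x‖ ≤ R).trans (le_abs_self R)
    have hy' : ‖evol c t y‖ ≤ |R| := by
      rw [norm_evol]; exact (by simpa using hy : ‖y‖ ≤ R).trans (le_abs_self R)
    have hxy : ‖evol c t x - evol c t y‖ = ‖x - y‖ := by rw [← map_sub, norm_evol]
    rw [dist_eq_norm, dist_eq_norm, field, field, ← map_sub, norm_evol, ← hxy]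
    generalize evol c t x = x at *
    generalize evol c t y = y at *
    have he : A t x + β t • B x x - (A t y + β t • B y y)
        = A t (x - y) + β t • (B x (x - y) + B (x - y) y) := by
      simp only [map_sub, sub_apply, smul_add, smul_sub]; abel
    have h1 : ‖A t (x - y)‖ ≤ M * ‖x - y‖ := (A t).le_of_opNorm_le (hM t ht) _
    have h2 : ‖B x (x - y)‖ ≤ ‖B‖ * |R| * ‖x - y‖ := (B.le_opNorm₂ _ _).trans (by gcongr)
    have h3 : ‖B (x - y) y‖ ≤ ‖B‖ * ‖x - y‖ * |R| := (B.le_opNorm₂ _ _).trans (by gcongr)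
    have h4 : ‖β t • (B x (x - y) + B (x - y) y)‖
        ≤ N * (‖B‖ * |R| * ‖x - y‖ + ‖B‖ * ‖x - y‖ * |R|) := by
      rw [norm_smul]
      exact mul_le_mul (hN t ht) ((norm_add_le _ _).trans (add_le_add h2 h3)) (norm_nonneg _)
        hN0.le
    rw [he]
    calc _ ≤ _ := norm_add_le _ _
      _ ≤ _ := add_le_add h1 h4
      _ = _ := by change _ = (M + N * (‖B‖ * (2 * |R|))) * _; ring
  · intro x
    have h1 : Continuous fun t => evol c t x := continuous_evol_apply c x
    have h2 := continuousOn_linear_add_quadratic B hA hβ h1.continuousOn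
    exact continuousOn_evol c continuousOn_neg h2

lemma field_mem_realSeq (c : ℝ) {A : ℝ → Seq →L[ℝ] Seq} {B : Seq →L[ℝ] Seq →L[ℝ] Seq}
    (β : ℝ → ℝ) (hA : ∀ t, ∀ x ∈ realSeq, A t x ∈ realSeq)
    (hB : ∀ x ∈ realSeq, ∀ y ∈ realSeq, B x y ∈ realSeq) (t : ℝ) (x : Seq) (hx : x ∈ realSeq) :
    field c A B β t x ∈ realSeq := by
  have h1 : evol c t x ∈ realSeq := IsReal.evol hx c t
  exact IsReal.evol (realSeq.add_mem (hA t _ h1) (realSeq.smul_mem _ (hB _ h1 _ h1))) c (-t)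

/-- By homogeneity the family of linear plus quadratic fields is stable under truncation, so bounds
for all coefficients cover the truncated equations. -/
lemma field_smul (c : ℝ) (A : ℝ → Seq →L[ℝ] Seq) (B : Seq →L[ℝ] Seq →L[ℝ] Seq) (β μ : ℝ → ℝ)
    (t : ℝ) (x : Seq) :
    field c A B β t (μ t • x) = field c (fun t => μ t • A t) B (fun t => μ t ^ 2 * β t) t x := by
  simp only [field, map_smul, smul_apply, smul_smul]
  congr 3
  ring

lemma norm_field_le (c : ℝ) (A : ℝ → Seq →L[ℝ] Seq) (B : Seq →L[ℝ] Seq →L[ℝ] Seq) (β : ℝ → ℝ)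
    (t : ℝ) (x : Seq) :
    ‖field c A B β t x‖ ≤ ‖A t‖ * ‖x‖ + |β t| * ‖B (evol c t x) (evol c t x)‖ := by
  rw [field, norm_evol]
  refine (norm_add_le _ _).trans (add_le_add ?_ ?_)
  · exact ((A t).le_opNorm _).trans_eq (by rw [norm_evol])
  · rw [norm_smul, Real.norm_eq_abs]

lemma damp_mem_realSeq {b : ℤ → ℂ} (hb : RapidDecay b) (hbr : IsReal b) (s : ℝ) (x : Seq)
    (hx : x ∈ realSeq) : damp hb s x ∈ realSeq := by
  rw [mem_realSeq, coe_damp]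
  exact (IsReal.dampSeq hbr (IsReal.wt hx _)).wt _

lemma quad_mem_realSeq (s : ℝ) (hs : 0 ≤ s) (x : Seq) (hx : x ∈ realSeq) (y : Seq)
    (hy : y ∈ realSeq) : quad s hs x y ∈ realSeq := by
  rw [mem_realSeq, coe_quad]
  exact (IsReal.quadSeq (IsReal.wt hx _) (IsReal.wt hy _)).wt _

lemma mixedQuad_mem_realSeq (x : Seq) (hx : x ∈ realSeq) (y : Seq)
    (hy : y ∈ realSeq) : mixedQuad x y ∈ realSeq := by
  rw [mem_realSeq, coe_mixedQuad]
  exact (IsReal.quadSeq hx (IsReal.wt hy _)).wt _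

lemma smoothing_mem_realSeq (s : ℝ) (hs : 0 ≤ s) (x : Seq) (hx : x ∈ realSeq) :
    smoothing s hs x ∈ realSeq :=
  IsReal.wt hx _

/-! ### Global solvability of the conjugated equation -/

/-- The equation with coefficients `α`, `β` in front of the damping and of the nonlinearity, in
the interaction picture and conjugated with the weight of order `s`. -/
def kdvField (c : ℝ) {b : ℤ → ℂ} (hb : RapidDecay b) (s : ℝ) (hs : 0 ≤ s) (α β : ℝ → ℝ) :
    ℝ → Seq → Seq :=
  field c (fun t => -(α t • damp hb s)) (quad s hs) β

section

variable (c : ℝ) {b : ℤ → ℂ} (hb : RapidDecay b) (s : ℝ) (hs : 0 ≤ s)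

lemma isRegularField_kdvField {α β : ℝ → ℝ} {T : ℝ} (hα : ContinuousOn α (Set.Icc 0 T))
    (hβ : ContinuousOn β (Set.Icc 0 T)) : IsRegularField (kdvField c hb s hs α β) T :=
  isRegularField_field c _ (hα.smul continuousOn_const).neg hβ

lemma kdvField_mem_realSeq (hbr : IsReal b) (α β : ℝ → ℝ) (t : ℝ) (x : Seq)
    (hx : x ∈ realSeq) : kdvField c hb s hs α β t x ∈ realSeq :=
  field_mem_realSeq c β
    (fun t x hx => realSeq.neg_mem (realSeq.smul_mem (α t) (damp_mem_realSeq hb hbr s x hx)))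
    (quad_mem_realSeq s hs) t x hx

lemma kdvField_smul (α β μ : ℝ → ℝ) (t : ℝ) (x : Seq) :
    kdvField c hb s hs α β t (μ t • x)
      = kdvField c hb s hs (fun t => μ t * α t) (fun t => μ t ^ 2 * β t) t x := by
  rw [kdvField, field_smul, kdvField]
  congr 1
  funext t
  rw [smul_neg, smul_smul]

/-- This makes a solution in the H^s variables a solution in the L² variables, with the same
coefficients α and β. -/
lemma smoothing_kdvField (α β : ℝ → ℝ) (t : ℝ) (x : Seq) :
    smoothing s hs (kdvField c hb s hs α β t x)
      = kdvField c hb 0 le_rfl α β t (smoothing s hs x) := by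
  simp only [kdvField, field, smoothing_evol, map_add, map_smul, smoothing_quad,
    neg_apply, smul_apply, map_neg, smoothing_damp]

/-- The growth rate depends on x only through its L² norm, so a bound in L² yields one in H^s by
Grönwall's inequality. -/
lemma norm_kdvField_le {α β : ℝ → ℝ} {t : ℝ} (hα : α t ∈ Set.Icc (0 : ℝ) 1)
    (hβ : β t ∈ Set.Icc (0 : ℝ) 1) (x : Seq) :
    ‖kdvField c hb s hs α β t x‖
      ≤ (‖damp hb s‖ + 2 ^ s * 2 * ‖invJap‖ * ‖smoothing s hs x‖) * ‖x‖ := by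
  refine (norm_field_le _ _ _ _ _ _).trans ?_
  have h1 : ‖-(α t • damp hb s)‖ ≤ ‖damp hb s‖ := by
    rw [norm_neg, norm_smul, Real.norm_of_nonneg hα.1]
    exact mul_le_of_le_one_left (norm_nonneg _) hα.2
  have h2 := norm_quad_le s hs (evol c t x) (evol c t x)
  rw [smoothing_evol, norm_evol, norm_evol] at h2
  have h3 : |β t| * ‖quad s hs (evol c t x) (evol c t x)‖
      ≤ ‖quad s hs (evol c t x) (evol c t x)‖ := by
    rw [abs_of_nonneg hβ.1]
    exact mul_le_of_le_one_left (norm_nonneg _) hβ.2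
  calc _ ≤ ‖damp hb s‖ * ‖x‖ + 2 ^ s * (‖x‖ * ‖smoothing s hs x‖
        + ‖smoothing s hs x‖ * ‖x‖) * ‖invJap‖ :=
        add_le_add (mul_le_mul_of_nonneg_right h1 (norm_nonneg _)) (h3.trans h2)
    _ = _ := by ring

/-- Solvability in `L²` for small initial states. -/
lemma exists_solution_of_small (hbr : IsReal b) {T : ℝ} (hT : 0 ≤ T) :
    ∃ ε : ℝ, 0 < ε ∧ ∀ v₀ ∈ realSeq, ‖v₀‖ ≤ ε → ∀ α β : ℝ → ℝ,
      ContinuousOn α (Set.Icc 0 T) → ContinuousOn β (Set.Icc 0 T) →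
      (∀ t, α t ∈ Set.Icc (0 : ℝ) 1) → (∀ t, β t ∈ Set.Icc (0 : ℝ) 1) →
      ∃ v : ℝ → Seq, v 0 = v₀ ∧ (∀ t, v t ∈ realSeq) ∧ (∀ t ∈ Set.Icc 0 T, ‖v t‖ ≤ 1) ∧
        SolvesODE (kdvField c hb 0 le_rfl α β) T v := by
  set K := ‖damp hb 0‖ + ‖quad 0 le_rfl‖ with hK
  -- Truncation at radius 1 makes the quadratic term at most ‖quad‖ ‖y‖. The norm then grows by at
  -- most exp(KT), and data of size exp(-KT) stay in the unit ball.
  refine ⟨Real.exp (-(K * T)), Real.exp_pos _, fun v₀ hv₀ hsmall α β hα hβ hα1 hβ1 => ?_⟩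
  refine exists_solvesODE_mem_of_apriori realSeq isClosed_realSeq hT
    (isRegularField_kdvField c hb 0 le_rfl hα hβ) (kdvField_mem_realSeq c hb 0 le_rfl hbr α β)
    one_pos hv₀ fun μ y hμ hμy hy0 hyr hy t ht => ?_
  have h := hy.norm_le (K := K) (by positivity) (fun t ht => ?_) t ht
  · rw [hy0] at h
    refine h.trans ((mul_le_mul_of_nonneg_right hsmall (Real.exp_pos _).le).trans_eq ?_)
    rw [← Real.exp_add]; simp
  · obtain ⟨h0, h1, h2⟩ := hμy t
    refine (norm_field_le _ _ _ _ _ _).trans ?_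
    have h3 : ‖-(α t • damp hb 0)‖ ≤ ‖damp hb 0‖ := by
      rw [norm_neg, norm_smul, Real.norm_of_nonneg (hα1 t).1]
      exact mul_le_of_le_one_left (norm_nonneg _) (hα1 t).2
    have h4 : ‖μ t • y t‖ ≤ ‖y t‖ := by
      rw [norm_smul, Real.norm_of_nonneg h0]
      exact mul_le_of_le_one_left (norm_nonneg _) h1
    have h5 := (quad 0 le_rfl).le_opNorm₂ (evol c t (μ t • y t)) (evol c t (μ t • y t))
    rw [norm_evol] at h5
    have h6 : |β t| ≤ 1 := by rw [abs_of_nonneg (hβ1 t).1]; exact (hβ1 t).2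
    calc _ ≤ ‖damp hb 0‖ * ‖y t‖ + 1 * (‖quad 0 le_rfl‖ * 1 * ‖y t‖) := by
          gcongr
          exact h5.trans (by gcongr)
      _ = K * ‖y t‖ := by rw [hK]; ring

/-- The linear part of the equation in `H¹` perturbed by a given `L²` solution. -/
def perturbOp (α β : ℝ → ℝ) (v : ℝ → Seq) (t : ℝ) : Seq →L[ℝ] Seq :=
  -(α t • damp hb 1) + β t • (2 : ℝ) • mixedQuad (evol c t (v t))

lemma continuousOn_perturbOp {α β : ℝ → ℝ} {v : ℝ → Seq} {T : ℝ}
    (hα : ContinuousOn α (Set.Icc 0 T)) (hβ : ContinuousOn β (Set.Icc 0 T))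
    (hv : ContinuousOn v (Set.Icc 0 T)) :
    ContinuousOn (perturbOp c hb α β v) (Set.Icc 0 T) := by
  have hev : ContinuousOn (fun t => evol c t (v t)) (Set.Icc 0 T) :=
    continuousOn_evol c continuousOn_id hv
  exact continuousOn_neg_add_smul (damp hb 1) mixedQuad hα hβ hev

lemma perturbOp_mem_realSeq (hbr : IsReal b) (α β : ℝ → ℝ) {v : ℝ → Seq}
    (hv : ∀ t, v t ∈ realSeq) (t : ℝ) (x : Seq) (hx : x ∈ realSeq) :
    perturbOp c hb α β v t x ∈ realSeq := by
  have h1 := realSeq.neg_mem (realSeq.smul_mem (α t) (damp_mem_realSeq hb hbr 1 x hx))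
  have h2 := realSeq.smul_mem (β t) (realSeq.smul_mem (2 : ℝ)
    (mixedQuad_mem_realSeq _ (IsReal.evol (hv t) c t) x hx))
  exact realSeq.add_mem h1 h2

lemma norm_perturbOp_le {α β : ℝ → ℝ} {v : ℝ → Seq} {t : ℝ} (hα : α t ∈ Set.Icc (0 : ℝ) 1)
    (hβ : β t ∈ Set.Icc (0 : ℝ) 1) (hv : ‖v t‖ ≤ 1) :
    ‖perturbOp c hb α β v t‖ ≤ ‖damp hb 1‖ + 2 * ‖mixedQuad‖ :=
  norm_neg_add_smul_le (damp hb 1) mixedQuad hα hβ ((norm_evol c t _).trans_le hv)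

/-- Solvability in `H¹` of the equation perturbed by a given `L²` solution. -/
lemma exists_perturbation (hbr : IsReal b) {T : ℝ} (hT : 0 ≤ T) {g₀ : Seq} (hg₀ : g₀ ∈ realSeq) :
    ∃ R : ℝ, 0 < R ∧ ∀ α β : ℝ → ℝ,
      ContinuousOn α (Set.Icc 0 T) → ContinuousOn β (Set.Icc 0 T) →
      (∀ t, α t ∈ Set.Icc (0 : ℝ) 1) → (∀ t, β t ∈ Set.Icc (0 : ℝ) 1) →
      ∀ v : ℝ → Seq, (∀ t, v t ∈ realSeq) → ContinuousOn v (Set.Icc 0 T) →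
      (∀ t ∈ Set.Icc 0 T, ‖v t‖ ≤ 1) →
      ∃ g : ℝ → Seq, g 0 = g₀ ∧ (∀ t, g t ∈ realSeq) ∧ (∀ t ∈ Set.Icc 0 T, ‖g t‖ ≤ R) ∧
        SolvesODE (field c (perturbOp c hb α β v) (quad 1 zero_le_one) β) T g := by
  set K := ‖damp hb 1‖ + 2 * ‖mixedQuad‖ with hK
  -- The summand 1 only keeps the radius positive when g₀ = 0.
  refine ⟨‖g₀‖ * Real.exp (K * T) + 1, by positivity, fun α β hα hβ hα1 hβ1 v hvr hv hv1 => ?_⟩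
  have hAc := continuousOn_perturbOp c hb hα hβ hv
  have hAr := perturbOp_mem_realSeq c hb hbr α β hvr
  have hAn : ∀ t ∈ Set.Icc 0 T, ‖perturbOp c hb α β v t‖ ≤ K := fun t ht =>
    norm_perturbOp_le c hb (hα1 t) (hβ1 t) (hv1 t ht)
  refine exists_solvesODE_mem_of_apriori realSeq isClosed_realSeq hT
    (isRegularField_field c (quad 1 zero_le_one) hAc hβ)
    (field_mem_realSeq c β hAr (quad_mem_realSeq 1 zero_le_one))
    (by positivity) hg₀ fun μ y hμ hμy hy0 hyr hy t ht => ?_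
  have h := hy.norm_le_of_inner (K := K) (by positivity) (fun t ht => ?_) t ht
  · rw [hy0] at h; linarith
  · obtain ⟨h0, h1, -⟩ := hμy t
    -- The group passes to the other side of the inner product, the quadratic term cancels, and only
    -- the bounded linear part contributes to the energy.
    rw [field_smul, field, inner_evol_neg, inner_add_right, Seq.real_smul,
      inner_smul_right, inner_quad_one_eq_zero (IsReal.evol (hyr t) c t), mul_zero, add_zero]
    refine (Complex.re_le_norm _).trans ((norm_inner_le_norm _ _).trans ?_)
    have h2 : ‖μ t • perturbOp c hb α β v t‖ ≤ K := by
      rw [norm_smul, Real.norm_of_nonneg h0]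
      exact (mul_le_of_le_one_left (norm_nonneg _) h1).trans (hAn t ht)
    have h3 := (μ t • perturbOp c hb α β v t).le_of_opNorm_le h2 (evol c t (y t))
    calc _ ≤ ‖evol c t (y t)‖ * (K * ‖evol c t (y t)‖) := by gcongr
      _ = K * ‖y t‖ ^ 2 := by rw [norm_evol]; ring

/-- Decomposition into a small part and a smooth part. -/
lemma exists_split {x : Seq} (hx : x ∈ realSeq) {ε : ℝ} (hε : 0 < ε) :
    ∃ v ∈ realSeq, ∃ g ∈ realSeq, ‖v‖ ≤ ε ∧ x = v + smoothing 1 zero_le_one g := by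
  have h1 := tendsto_tsum_compl_atTop_zero (fun k => ‖x k‖ ^ 2)
  obtain ⟨S, hS⟩ := ((tendsto_order.mp h1).2 (ε ^ 2) (by positivity)).exists_forall_of_atTop
  -- The set of low frequencies is made symmetric so that both pieces come from real functions.
  set S' := S ∪ S.map (Equiv.neg ℤ).toEmbedding with hS'
  have hsymm : ∀ k, -k ∈ S' ↔ k ∈ S' := fun k => by
    simp only [hS', Finset.mem_union, Finset.mem_map_equiv, Equiv.neg_symm, Equiv.neg_apply,
      neg_neg]
    exact or_comm
  have htail := hS S' Finset.subset_union_left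
  classical
  let v : Seq := Seq.mk (fun k => if k ∈ S' then 0 else x k) (memSeq_of_le x (C := 1) fun k => by
    split_ifs <;> simp)
  let g : Seq := Seq.mk (fun k => if k ∈ S' then (jap 1 k : ℂ) * x k else 0) (memSeq_iff.mpr
    (summable_of_ne_finset_zero (s := S') fun k hk => by simp [hk]))
  have hvk : ∀ k, v k = if k ∈ S' then 0 else x k := fun k => rfl
  have hgk : ∀ k, g k = if k ∈ S' then (jap 1 k : ℂ) * x k else 0 := fun k => rfl
  refine ⟨v, fun k => ?_, g, fun k => ?_, ?_, ?_⟩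
  · rw [hvk, hvk]; simp only [hsymm]
    split_ifs
    · simp
    · exact hx k
  · rw [hgk, hgk]; simp only [hsymm]
    split_ifs
    · rw [hx k, map_mul, Complex.conj_ofReal, jap_neg_arg]
    · simp
  · refine abs_le_of_sq_le_sq ?_ hε.le |> (le_abs_self _).trans
    rw [← v.hasSum_sq.tsum_eq]
    refine le_trans (le_of_eq ?_) htail.le
    rw [← Function.Injective.tsum_eq (g := ((↑) : {k // k ∉ S'} → ℤ)) Subtype.val_injective]
    · refine tsum_congr fun k => ?_
      rw [hvk, if_neg k.2]
    · intro k hk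
      have : k ∉ S' := fun h => hk (by simp [hvk, h])
      exact ⟨⟨k, this⟩, rfl⟩
  · apply Seq.ext; funext k
    rw [Seq.coe_add, Pi.add_apply, coe_smoothing, wt, hvk, hgk]
    split_ifs
    · rw [← mul_assoc, ← Complex.ofReal_mul, jap_neg_mul]; simp
    · simp

/-- Solvability in `L²`, with a bound that is uniform in the coefficients of the equation. -/
lemma exists_solution_L2 (hbr : IsReal b) {T : ℝ} (hT : 0 ≤ T) {x₀ : Seq} (hx₀ : x₀ ∈ realSeq) :
    ∃ M : ℝ, 0 < M ∧ ∀ α β : ℝ → ℝ,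
      ContinuousOn α (Set.Icc 0 T) → ContinuousOn β (Set.Icc 0 T) →
      (∀ t, α t ∈ Set.Icc (0 : ℝ) 1) → (∀ t, β t ∈ Set.Icc (0 : ℝ) 1) →
      ∃ u : ℝ → Seq, u 0 = x₀ ∧ (∀ t ∈ Set.Icc 0 T, ‖u t‖ ≤ M) ∧
        SolvesODE (kdvField c hb 0 le_rfl α β) T u := by
  obtain ⟨ε, hε, hsmall⟩ := exists_solution_of_small c hb hbr hT
  obtain ⟨v₀, hv₀, g₀, hg₀, hv₀ε, rfl⟩ := exists_split hx₀ hε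
  obtain ⟨R, hR, hpert⟩ := exists_perturbation c hb hbr hT hg₀
  refine ⟨1 + R, by positivity, fun α β hα hβ hα1 hβ1 => ?_⟩
  obtain ⟨v, hv0, hvr, hv1, hv⟩ := hsmall v₀ hv₀ hv₀ε α β hα hβ hα1 hβ1
  obtain ⟨g, hg0, -, hgR, hg⟩ := hpert α β hα hβ hα1 hβ1 v hvr hv.continuousOn hv1
  refine ⟨fun t => v t + smoothing 1 zero_le_one (g t), by simp only [hv0, hg0], fun t ht => ?_,
    fun t ht => ?_⟩
  · exact (norm_add_le _ _).trans
      (add_le_add (hv1 t ht) ((norm_smoothing_le 1 zero_le_one _).trans (hgR t ht)))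
  · have h := (hv t ht).add
      ((smoothing 1 zero_le_one).hasFDerivAt.comp_hasDerivWithinAt t (hg t ht))
    refine h.congr_deriv ?_
    simp only [kdvField, field, perturbOp, smoothing_evol, map_add, map_smul, smoothing_quad,
      neg_apply, smul_apply, map_neg, smoothing_damp,
      add_apply, smoothing_mixedQuad]
    -- By symmetry the two cross terms of the sum merge into the factor 2 of `perturbOp`.
    rw [quad_comm 0 le_rfl (evol c t (smoothing 1 zero_le_one (g t))) (evol c t (v t))]
    module

/-- Solvability in `H^s`. -/
theorem exists_solution_weighted (hbr : IsReal b) {T : ℝ} (hT : 0 ≤ T) {x₀ : Seq}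
    (hx₀ : x₀ ∈ realSeq) :
    ∃ y : ℝ → Seq, y 0 = x₀ ∧ (∀ t, y t ∈ realSeq) ∧
      SolvesODE (kdvField c hb s hs 1 1) T y := by
  -- M has to be fixed before α and β, which will come from the truncation and depend on the
  -- solution to be bounded.
  obtain ⟨M, hM, hL2⟩ := exists_solution_L2 c hb hbr hT (smoothing_mem_realSeq s hs x₀ hx₀)
  set K := ‖damp hb s‖ + 2 ^ s * 2 * ‖invJap‖ * M with hK
  have hK0 : 0 ≤ K := by positivity
  refine Exists.imp (fun y h => ⟨h.1, h.2.1, h.2.2.2⟩)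
    (exists_solvesODE_mem_of_apriori realSeq isClosed_realSeq hT
    (isRegularField_kdvField c hb s hs (α := 1) (β := 1) continuousOn_const continuousOn_const)
    (kdvField_mem_realSeq c hb s hs hbr 1 1) (R := ‖x₀‖ * Real.exp (K * T) + 1) (by positivity)
    hx₀ fun μ y hμ hμy hy0 hyr hy t ht => ?_)
  set α : ℝ → ℝ := fun t => μ t * (1 : ℝ → ℝ) t with hα
  set β : ℝ → ℝ := fun t => μ t ^ 2 * (1 : ℝ → ℝ) t with hβ
  have hα1 : ∀ t, α t ∈ Set.Icc (0 : ℝ) 1 := fun t => by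
    simpa [hα] using ⟨(hμy t).1, (hμy t).2.1⟩
  have hβ1 : ∀ t, β t ∈ Set.Icc (0 : ℝ) 1 := fun t => by
    simp only [hβ, Pi.one_apply, mul_one]
    exact ⟨sq_nonneg (μ t), pow_le_one₀ (hμy t).1 (hμy t).2.1⟩
  have hαc : ContinuousOn α (Set.Icc 0 T) := hμ.mul continuousOn_const
  have hβc : ContinuousOn β (Set.Icc 0 T) := (hμ.pow 2).mul continuousOn_const
  have hy' : SolvesODE (kdvField c hb s hs α β) T y := fun t ht => by
    rw [← kdvField_smul]; exact hy t ht
  have hsy : SolvesODE (kdvField c hb 0 le_rfl α β) T (fun t => smoothing s hs (y t)) :=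
    fun t ht => by
    rw [← smoothing_kdvField]
    exact (smoothing s hs).hasFDerivAt.comp_hasDerivWithinAt t (hy' t ht)
  obtain ⟨u, hu0, huM, hu⟩ := hL2 α β hαc hβc hα1 hβ1
  -- Uniqueness in L² identifies the given solution with the one constructed by splitting, and so
  -- transfers the bound M to it.
  have heq := hsy.eqOn (isRegularField_kdvField c hb 0 le_rfl hαc hβc) hu (by rw [hy0, hu0])
  have h := hy'.norm_le hK0 (fun t ht => ?_) t ht
  · rw [hy0] at h; linarith
  · refine (norm_kdvField_le c hb s hs (hα1 t) (hβ1 t) (y t)).trans ?_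
    have h1 : ‖smoothing s hs (y t)‖ ≤ M := by
      have := heq ht
      simp only at this
      rw [this]; exact huM t ht
    rw [hK]; gcongr

end

/-! ### Fourier coefficients of square integrable functions -/

/-- The normalized Haar measure of the torus. -/
abbrev haar : Measure Torus := AddCircle.haarAddCircle

/-- A real function, seen as a complex one. -/
def toComplex (u : L2) : Lp ℂ 2 haar := Complex.ofRealCLM.compLp u

lemma coeFn_toComplex (u : L2) : toComplex u =ᵐ[haar] fun x => ((u x : ℝ) : ℂ) :=
  Complex.ofRealCLM.coeFn_compLp' u

/-- The sequence of Fourier coefficients. -/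
def toSeq (u : L2) : Seq := (fourierBasis.repr (toComplex u) : lp (fun _ : ℤ => ℂ) 2)

lemma coe_toSeq (u : L2) : (toSeq u : ℤ → ℂ) = coeff u := by
  funext k
  change fourierBasis.repr (toComplex u) k = _
  rw [fourierBasis_repr]
  exact congrFun (fourierCoeff_congr_ae (coeFn_toComplex u)) k

lemma toComplex_injective : Function.Injective toComplex := fun u v h => by
  apply Lp.ext
  have h1 := coeFn_toComplex u
  rw [h] at h1
  filter_upwards [h1, coeFn_toComplex v] with x hx hx'
  exact Complex.ofReal_injective (hx.symm.trans hx')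

lemma toSeq_injective : Function.Injective toSeq := fun _ _ h =>
  toComplex_injective (fourierBasis.repr.injective h)

lemma toSeq_sub (u v : L2) : toSeq (u - v) = toSeq u - toSeq v := by
  have : toComplex (u - v) = toComplex u - toComplex v := by
    apply Lp.ext
    filter_upwards [coeFn_toComplex (u - v), coeFn_toComplex u, coeFn_toComplex v,
      Lp.coeFn_sub u v, Lp.coeFn_sub (toComplex u) (toComplex v)] with x h1 h2 h3 h4 h5
    rw [h1, h4, h5, Pi.sub_apply, Pi.sub_apply, h2, h3, Complex.ofReal_sub]
  change fourierBasis.repr (toComplex (u - v)) = _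
  rw [this, map_sub]
  rfl

lemma coeff_sub (u v : L2) : coeff (u - v) = coeff u - coeff v := by
  rw [← coe_toSeq, toSeq_sub, Seq.coe_sub, coe_toSeq, coe_toSeq]

lemma isReal_fourierCoeff (f : Torus → ℝ) : IsReal (fourierCoeff fun x => (f x : ℂ)) :=
  fun k => by
  rw [fourierCoeff, fourierCoeff, ← integral_conj]
  congr 1
  funext x
  rw [smul_eq_mul, smul_eq_mul, map_mul, Complex.conj_ofReal, neg_neg, fourier_neg,
    Complex.conj_conj]

lemma isReal_coeff (u : L2) : IsReal (coeff u) := isReal_fourierCoeff _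

/-- By symmetry, the complex function with these coefficients and its conjugate have the same
coefficients. It is thus real almost everywhere, and u is its real part. -/
lemma exists_coeff_eq {f : Seq} (hf : IsReal f) : ∃ u : L2, coeff u = f := by
  let g : Lp ℂ 2 haar := fourierBasis.repr.symm (f : lp (fun _ : ℤ => ℂ) 2)
  have hg : ∀ k, fourierCoeff g k = f k := fun k => by
    rw [← fourierBasis_repr]
    exact congrFun (congrArg Seq.entry (fourierBasis.repr.apply_symm_apply f)) k
  let h : Lp ℂ 2 haar := star g
  have hhg : h =ᵐ[haar] fun x => conj (g x) := Lp.coeFn_star g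
  have hh : ∀ k, fourierCoeff h k = f k := fun k => by
    rw [fourierCoeff_congr_ae hhg]
    have h1 : fourierCoeff (fun x => conj (g x)) k = conj (fourierCoeff g (-k)) := by
      rw [fourierCoeff, fourierCoeff, ← integral_conj]
      congr 1
      funext x
      rw [smul_eq_mul, smul_eq_mul, map_mul, neg_neg, fourier_neg]
    rw [h1, hg, hf k, Complex.conj_conj]
  have hgh : h = g := by
    apply fourierBasis.repr.injective
    apply lp.ext
    funext k
    rw [fourierBasis_repr, fourierBasis_repr, hh, hg]
  let u : L2 := Complex.reCLM.compLp g
  refine ⟨u, funext fun k => ?_⟩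
  rw [coeff, ← hg]
  refine congrFun (fourierCoeff_congr_ae ?_) k
  filter_upwards [Complex.reCLM.coeFn_compLp' g, hhg] with x h1 h2
  rw [hgh] at h2
  rw [h1, Complex.reCLM_apply]
  exact Complex.conj_eq_iff_re.mp h2.symm

lemma memLp_coe (u : L2) : MemLp (fun x => ((u x : ℝ) : ℂ)) 2 haar :=
  (memLp_congr_ae (coeFn_toComplex u)).mp (Lp.memLp (toComplex u))

/-- The Fourier coefficients of a product. -/
lemma fourierCoeff_mul {f g : Torus → ℂ} (hf : MemLp f 2 haar) (hg : MemLp g 2 haar) (k : ℤ) :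
    fourierCoeff (fun x => f x * g x) k = conv (fourierCoeff f) (fourierCoeff g) k := by
  -- The coefficient of f g at k is the inner product of this function with g; Parseval's identity
  -- expands it into the convolution.
  have hF : MemLp (fun x => conj (fourier (-k) x * f x)) 2 haar := by
    refine hf.congr_norm ?_ (Eventually.of_forall fun x => ?_)
    · exact Complex.continuous_conj.comp_aestronglyMeasurable
        ((fourier (-k)).continuous.aestronglyMeasurable.mul hf.aestronglyMeasurable)
    · rw [RCLike.norm_conj, norm_mul, fourier_apply, Circle.norm_coe, one_mul]
  have h := (fourierBasis (T := 2 * Real.pi)).tsum_inner_mul_inner (hF.toLp _) (hg.toLp _)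
  have h1 : ∀ j, inner ℂ (fourierBasis (T := 2 * Real.pi) j) (hg.toLp _) = fourierCoeff g j :=
    fun j => by
    rw [← HilbertBasis.repr_apply_apply, fourierBasis_repr]
    exact congrFun (fourierCoeff_congr_ae hg.coeFn_toLp) j
  have h2 : ∀ j, inner ℂ (hF.toLp _) (fourierBasis (T := 2 * Real.pi) j)
      = fourierCoeff f (k - j) := fun j => by
    rw [← inner_conj_symm, ← HilbertBasis.repr_apply_apply, fourierBasis_repr,
      fourierCoeff_congr_ae hF.coeFn_toLp, fourierCoeff, fourierCoeff, ← integral_conj]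
    congr 1
    funext x
    rw [smul_eq_mul, smul_eq_mul, map_mul, Complex.conj_conj, ← fourier_neg, neg_neg, ← mul_assoc,
      ← fourier_add]
    congr 3; ring
  have h3 : inner ℂ (hF.toLp _) (hg.toLp _) = fourierCoeff (fun x => f x * g x) k := by
    rw [MeasureTheory.L2.inner_def, fourierCoeff]
    refine integral_congr_ae ?_
    filter_upwards [hF.coeFn_toLp, hg.coeFn_toLp] with x hx hx'
    rw [hx, hx', RCLike.inner_apply, Complex.conj_conj, smul_eq_mul]; ring
  rw [← h3, ← h, conv]
  exact tsum_congr fun j => by rw [h1, h2]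

/-! ### Fourier coefficients of test functions -/

/-- The Fourier coefficients of a periodic function on the line. -/
def testCoeff (φ : ℝ → ℝ) (k : ℤ) : ℂ :=
  fourierCoeffOn Real.two_pi_pos (fun x => (φ x : ℂ)) k

lemma testCoeff_eq {φ : ℝ → ℝ} (hφ : Function.Periodic φ (2 * Real.pi)) :
    testCoeff φ = fourierCoeff (fun x : Torus => ((hφ.lift x : ℝ) : ℂ)) := by
  funext k
  rw [testCoeff, fourierCoeffOn_eq_integral, fourierCoeff_eq_intervalIntegral _ _ 0, zero_add,
    sub_zero]
  congr 1

lemma isReal_testCoeff {φ : ℝ → ℝ} (hφ : Function.Periodic φ (2 * Real.pi)) :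
    IsReal (testCoeff φ) := by
  rw [testCoeff_eq hφ]; exact isReal_fourierCoeff _

lemma IsSmoothPeriodic.continuous_lift {φ : ℝ → ℝ} (hφ : IsSmoothPeriodic φ) :
    Continuous (hφ.2.lift : Torus → ℝ) :=
  continuous_coinduced_dom.mpr hφ.1.continuous

lemma IsSmoothPeriodic.deriv {φ : ℝ → ℝ} (hφ : IsSmoothPeriodic φ) :
    IsSmoothPeriodic (deriv φ) := by
  refine ⟨(contDiff_infty_iff_deriv.mp hφ.1).2, fun x => ?_⟩
  have : (fun x => φ (x + 2 * Real.pi)) = φ := funext hφ.2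
  rw [← deriv_comp_add_const, this]

lemma IsSmoothPeriodic.mul {φ ψ : ℝ → ℝ} (hφ : IsSmoothPeriodic φ) (hψ : IsSmoothPeriodic ψ) :
    IsSmoothPeriodic (fun x => φ x * ψ x) :=
  ⟨hφ.1.mul hψ.1, fun x => by simp only [hφ.2 x, hψ.2 x]⟩

lemma IsSmoothPeriodic.sub {φ ψ : ℝ → ℝ} (hφ : IsSmoothPeriodic φ) (hψ : IsSmoothPeriodic ψ) :
    IsSmoothPeriodic (fun x => φ x - ψ x) :=
  ⟨hφ.1.sub hψ.1, fun x => by simp only [hφ.2 x, hψ.2 x]⟩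

lemma testCoeff_deriv {φ : ℝ → ℝ} (hφ : IsSmoothPeriodic φ) (k : ℤ) :
    testCoeff (deriv φ) k = Complex.I * k * testCoeff φ k := by
  have hd : ∀ x, HasDerivAt (fun x => (φ x : ℂ)) ((deriv φ x : ℝ) : ℂ) x := fun x =>
    ((hφ.1.differentiable (by simp)).differentiableAt.hasDerivAt).ofReal_comp
  have hc : IntervalIntegrable (fun x => ((deriv φ x : ℝ) : ℂ)) volume 0 (2 * Real.pi) :=
    (Complex.continuous_ofReal.comp hφ.deriv.1.continuous).intervalIntegrable _ _
  have hper : φ (2 * Real.pi) = φ 0 := by simpa using hφ.2 0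
  rcases eq_or_ne k 0 with rfl | hk
  · rw [testCoeff, fourierCoeffOn_eq_integral]
    simp only [neg_zero, fourier_zero, one_smul, Int.cast_zero, mul_zero, zero_mul]
    rw [intervalIntegral.integral_eq_sub_of_hasDerivAt (fun x _ => hd x) hc, hper]
    simp
  · rw [testCoeff, testCoeff, fourierCoeffOn_of_hasDerivAt Real.two_pi_pos hk
      (fun x _ => hd x) hc, hper, sub_self, mul_zero]
    have : (k : ℂ) ≠ 0 := by exact_mod_cast hk
    have hpi : (Real.pi : ℂ) ≠ 0 := by exact_mod_cast Real.pi_ne_zero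
    field_simp
    push_cast
    ring_nf

lemma testCoeff_sub {φ ψ : ℝ → ℝ} (hφ : IsSmoothPeriodic φ) (hψ : IsSmoothPeriodic ψ) (k : ℤ) :
    testCoeff (fun x => φ x - ψ x) k = testCoeff φ k - testCoeff ψ k := by
  have hc : ∀ φ : ℝ → ℝ, IsSmoothPeriodic φ → IntervalIntegrable (fun x : ℝ =>
      fourier (-k) (x : AddCircle (2 * Real.pi - 0)) • (φ x : ℂ)) volume 0 (2 * Real.pi) :=
    fun φ hφ => by
    refine Continuous.intervalIntegrable ?_ _ _
    exact ((fourier (-k)).continuous.comp (AddCircle.continuous_mk' _)).smul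
      (Complex.continuous_ofReal.comp hφ.1.continuous)
  simp only [testCoeff, fourierCoeffOn_eq_integral]
  rw [← smul_sub, ← intervalIntegral.integral_sub (hc φ hφ) (hc ψ hψ)]
  simp only [Complex.ofReal_sub, smul_sub]

/-- The test function `(1 - ∂²) φ`. -/
def helm (φ : ℝ → ℝ) : ℝ → ℝ := fun x => φ x - deriv (deriv φ) x

lemma IsSmoothPeriodic.helm {φ : ℝ → ℝ} (hφ : IsSmoothPeriodic φ) : IsSmoothPeriodic (helm φ) :=
  hφ.sub hφ.deriv.deriv

lemma testCoeff_helm {φ : ℝ → ℝ} (hφ : IsSmoothPeriodic φ) (k : ℤ) :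
    testCoeff (helm φ) k = (jap 2 k : ℂ) * testCoeff φ k := by
  unfold KdVBBM.helm
  rw [testCoeff_sub hφ hφ.deriv.deriv, testCoeff_deriv hφ.deriv, testCoeff_deriv hφ, jap_two]
  push_cast
  linear_combination (-(k : ℂ) ^ 2 * testCoeff φ k) * Complex.I_sq

lemma exists_norm_testCoeff_le {φ : ℝ → ℝ} (hφ : IsSmoothPeriodic φ) :
    ∃ C, ∀ k, ‖testCoeff φ k‖ ≤ C := by
  obtain ⟨C, hC⟩ := isCompact_univ.exists_bound_of_continuousOn
    (hφ.continuous_lift).continuousOn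
  refine ⟨C, fun k => ?_⟩
  rw [testCoeff_eq hφ.2, fourierCoeff]
  refine (norm_integral_le_of_norm_le_const (C := C) (Eventually.of_forall fun x => ?_)).trans_eq
    (by simp)
  rw [smul_eq_mul, norm_mul, fourier_apply, Circle.norm_coe, one_mul, Complex.norm_real]
  exact hC x trivial

/-- Each power of 1 - ∂² gains a factor 1 + k² over the trivial bound on Fourier coefficients; one
factor beyond the order r makes the series converge. -/
lemma rapidDecay_testCoeff {φ : ℝ → ℝ} (hφ : IsSmoothPeriodic φ) : RapidDecay (testCoeff φ) := by
  have key : ∀ n : ℕ, ∀ φ : ℝ → ℝ, IsSmoothPeriodic φ →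
      ∃ C, ∀ k, jap (2 * n) k * ‖testCoeff φ k‖ ≤ C := by
    intro n
    induction n with
    | zero =>
      intro φ hφ
      simpa [jap_zero] using exists_norm_testCoeff_le hφ
    | succ n ih =>
      intro φ hφ
      obtain ⟨C, hC⟩ := ih _ hφ.helm
      refine ⟨C, fun k => ?_⟩
      have := hC k
      rw [testCoeff_helm hφ, norm_mul, Complex.norm_real, Real.norm_of_nonneg (jap_pos _ k).le,
        ← mul_assoc, ← jap_add] at this
      convert this using 3
      push_cast; ring
  intro r
  obtain ⟨n, hn⟩ := exists_nat_ge ((r + 2) / 2)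
  obtain ⟨C, hC⟩ := key n φ hφ
  refine Summable.of_nonneg_of_le (fun k => mul_nonneg (jap_pos r k).le (norm_nonneg _))
    (fun k => ?_) (summable_jap_neg_two.mul_left C)
  have h1 : jap r k ≤ jap (-2) k * jap (2 * n) k := by
    rw [← jap_add]
    exact jap_mono (by linarith) k
  calc jap r k * ‖testCoeff φ k‖ ≤ jap (-2) k * jap (2 * n) k * ‖testCoeff φ k‖ := by gcongr
    _ = jap (2 * n) k * ‖testCoeff φ k‖ * jap (-2) k := by ring
    _ ≤ C * jap (-2) k := mul_le_mul_of_nonneg_right (hC k) (jap_pos _ k).le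

/-- The pairing of an integrable function with a smooth one. -/
lemma hasSum_pairing {h : Torus → ℂ} (hh : Integrable h haar) {φ : ℝ → ℝ}
    (hφ : IsSmoothPeriodic φ) :
    HasSum (fun k => 2 * Real.pi * (testCoeff φ k * fourierCoeff h (-k)))
      (∫ x in (0 : ℝ)..(2 * Real.pi), h (x : Torus) * φ x) := by
  set Φ : C(Torus, ℂ) := ⟨fun x => ((hφ.2.lift x : ℝ) : ℂ),
    Complex.continuous_ofReal.comp hφ.continuous_lift⟩ with hΦ
  have hs : Summable (fourierCoeff Φ) := by
    have := (rapidDecay_testCoeff hφ) 0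
    simp only [jap_zero, one_mul] at this
    rw [testCoeff_eq hφ.2] at this
    exact this.of_norm
  have h1 : ∀ x, HasSum (fun k => h x * (testCoeff φ k * fourier k x)) (h x * Φ x) := fun x => by
    have := (has_pointwise_sum_fourier_series_of_summable hs x).mul_left (h x)
    rw [testCoeff_eq hφ.2]
    exact this
  have hnorm : ∀ k x, ‖h x * (testCoeff φ k * fourier k x)‖ = ‖testCoeff φ k‖ * ‖h x‖ :=
    fun k x => by
    rw [norm_mul, norm_mul, fourier_apply, Circle.norm_coe, mul_one, mul_comm]
  have h2 : HasSum (fun k => ∫ x, h x * (testCoeff φ k * fourier k x) ∂haar)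
      (∫ x, h x * Φ x ∂haar) := by
    have h3 := hasSum_integral_of_summable_integral_norm (μ := haar)
      (F := fun k x => h x * (testCoeff φ k * fourier k x)) (fun k => ?_) ?_
    · simp_rw [fun x => (h1 x).tsum_eq] at h3
      exact h3
    · refine hh.mul_bdd (c := ‖testCoeff φ k‖) ?_ (Eventually.of_forall fun x => ?_)
      · exact (continuous_const.mul (fourier k).continuous).aestronglyMeasurable
      · rw [norm_mul, fourier_apply, Circle.norm_coe, mul_one]
    · simp_rw [hnorm, integral_const_mul]
      refine Summable.mul_right _ ?_
      simpa only [jap_zero, one_mul] using rapidDecay_testCoeff hφ 0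
  have h4 : ∫ x in (0 : ℝ)..(2 * Real.pi), h (x : Torus) * φ x
      = 2 * Real.pi * ∫ x, h x * Φ x ∂haar := by
    have := AddCircle.intervalIntegral_preimage (2 * Real.pi) 0 (fun x => h x * Φ x)
    rw [zero_add] at this
    rw [AddCircle.integral_haarAddCircle, ← this, Complex.real_smul]
    push_cast
    rw [← mul_assoc, mul_inv_cancel₀ (by simp), one_mul]
    rfl
  rw [h4]
  refine (h2.mul_left _).congr_fun fun k => ?_
  congr 1
  rw [fourierCoeff, neg_neg, ← integral_const_mul]
  congr 1
  funext x
  rw [smul_eq_mul]; ring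

/-! ### The equation on the Fourier side -/

lemma hasSum_ofFun {h : Torus → ℝ} (hh : Integrable h haar) {φ : ℝ → ℝ}
    (hφ : IsSmoothPeriodic φ) :
    HasSum (fun k => 2 * Real.pi * (testCoeff φ k * fourierCoeff (fun x => (h x : ℂ)) (-k)))
      ((ofFun h φ : ℝ) : ℂ) := by
  have := hasSum_pairing hh.ofReal hφ
  rw [ofFun, ← intervalIntegral.integral_ofReal]
  simpa using this

lemma hasSum_helmholtz {h : Torus → ℝ} (hh : Integrable h haar) {φ : ℝ → ℝ}
    (hφ : IsSmoothPeriodic φ) :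
    HasSum (fun k => 2 * Real.pi *
        (testCoeff φ k * ((jap 2 k : ℂ) * fourierCoeff (fun x => (h x : ℂ)) (-k))))
      ((helmholtz (ofFun h) φ : ℝ) : ℂ) := by
  have h1 := (hasSum_ofFun hh hφ).sub (hasSum_ofFun hh hφ.deriv.deriv)
  have h2 : helmholtz (ofFun h) φ = ofFun h φ - ofFun h (deriv (deriv φ)) := by
    simp [helmholtz, ddx]
  rw [h2, Complex.ofReal_sub]
  refine h1.congr_fun fun k => ?_
  rw [testCoeff_deriv hφ.deriv, testCoeff_deriv hφ, jap_two]
  push_cast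
  linear_combination (2 * Real.pi * k ^ 2 * testCoeff φ k
    * fourierCoeff (fun x => (h x : ℂ)) (-k)) * Complex.I_sq

/-- The transpose of the multiplication by a smooth function. -/
lemma hasSum_conv_transpose {b p g : ℤ → ℂ} (hb : RapidDecay b) (hp : RapidDecay p) {C : ℝ}
    (hg : ∀ k, ‖g k‖ ≤ C * jap 2 k) {S : ℂ} (h : HasSum (fun l => conv b p l * g (-l)) S) :
    HasSum (fun j => p j * conv b g (-j)) S := by
  have hC : 0 ≤ C := by
    have := (norm_nonneg _).trans (hg 0)
    simpa [jap_two] using this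
  obtain ⟨F, hF⟩ : ∃ F : ℤ × ℤ → ℂ, F = fun q => b (q.1 - q.2) * p q.2 * g (-q.1) := ⟨_, rfl⟩
  have hs1 : Summable fun q : ℤ × ℤ => (jap 2 q.1 * ‖b q.1‖) * (jap 2 q.2 * ‖p q.2‖) :=
    (hb 2).mul_of_nonneg (hp 2) (fun k => mul_nonneg (jap_pos _ k).le (norm_nonneg _))
      (fun k => mul_nonneg (jap_pos _ k).le (norm_nonneg _))
  let e : ℤ × ℤ ≃ ℤ × ℤ :=
    { toFun := fun q => (q.1 - q.2, q.2)
      invFun := fun q => (q.1 + q.2, q.2)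
      left_inv := fun q => by simp
      right_inv := fun q => by simp }
  have hs2 : Summable fun q : ℤ × ℤ =>
      (jap 2 (q.1 - q.2) * ‖b (q.1 - q.2)‖) * (jap 2 q.2 * ‖p q.2‖) := e.summable_iff.mpr hs1
  -- Peetre's inequality shares the growth of g between b and p, whose decay absorbs it; this
  -- justifies exchanging the two summations.
  have hFs : Summable F := by
    refine Summable.of_norm_bounded (hs2.mul_left (C * 2)) fun q => ?_
    have h1 := jap_peetre 2 q.1 q.2
    norm_num at h1
    have h2 := hg (-q.1)
    rw [jap_neg_arg] at h2
    simp only [hF, norm_mul]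
    calc ‖b (q.1 - q.2)‖ * ‖p q.2‖ * ‖g (-q.1)‖
        ≤ ‖b (q.1 - q.2)‖ * ‖p q.2‖ * (C * (2 * jap 2 q.2 * jap 2 (q.1 - q.2))) := by
          gcongr
          exact h2.trans (mul_le_mul_of_nonneg_left h1 hC)
      _ = _ := by ring
  have h1 : ∑' q, F q = S := by
    rw [hFs.tsum_prod, ← h.tsum_eq]
    refine tsum_congr fun l => ?_
    rw [conv, ← tsum_mul_right, hF]
  obtain ⟨F', hF'⟩ : ∃ F' : ℤ × ℤ → ℂ, F' = fun q => F (q.2, q.1) := ⟨_, rfl⟩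
  have h2 : HasSum F' S := by
    rw [← h1, hF']
    exact (Equiv.prodComm ℤ ℤ).hasSum_iff.mpr hFs.hasSum
  have h3 : HasSum (fun j => ∑' l, F' (j, l)) S :=
    h2.prod_fiberwise fun j => (h2.summable.prod_factor j).hasSum
  refine h3.congr_fun fun j => ?_
  rw [conv, ← tsum_mul_left, ← (Equiv.neg ℤ).tsum_eq]
  refine tsum_congr fun l => ?_
  simp only [hF', hF, Equiv.neg_apply]
  rw [show -j - -l = l - j by ring]; ring

lemma integrable_coe (u : L2) : Integrable (fun x => (u x : ℝ)) haar :=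
  (Lp.memLp u).integrable one_le_two

lemma integrable_sq (u : L2) : Integrable (fun x => (u x : ℝ) ^ 2 / 2) haar :=
  (Lp.memLp u).integrable_sq.div_const 2

lemma memLp_lift_mul {a : ℝ → ℝ} (ha : IsSmoothPeriodic a) (u : L2) :
    Integrable (fun x => ha.2.lift x * u x) haar ∧
      fourierCoeff (fun x => ((ha.2.lift x * u x : ℝ) : ℂ)) = conv (testCoeff a) (coeff u) := by
  have hc : Continuous fun x : Torus => ((ha.2.lift x : ℝ) : ℂ) :=
    Complex.continuous_ofReal.comp ha.continuous_lift
  have h1 : MemLp (fun x : Torus => ((ha.2.lift x : ℝ) : ℂ)) 2 haar :=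
    hc.memLp_of_hasCompactSupport (HasCompactSupport.of_compactSpace _)
  refine ⟨?_, funext fun k => ?_⟩
  · exact MemLp.integrable_mul (p := 2) (q := 2)
      (ha.continuous_lift.memLp_of_hasCompactSupport (HasCompactSupport.of_compactSpace _))
      (Lp.memLp u)
  · have := fourierCoeff_mul h1 (memLp_coe u) k
    rw [testCoeff_eq ha.2]
    simp only [Complex.ofReal_mul]
    exact this

lemma testCoeff_mul {a φ : ℝ → ℝ} (ha : IsSmoothPeriodic a) (hφ : IsSmoothPeriodic φ) :
    testCoeff (fun x => a x * φ x) = conv (testCoeff a) (testCoeff φ) := by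
  have hm : ∀ {ψ : ℝ → ℝ} (hψ : IsSmoothPeriodic ψ),
      MemLp (fun x : Torus => ((hψ.2.lift x : ℝ) : ℂ)) 2 haar := fun hψ =>
    (Complex.continuous_ofReal.comp hψ.continuous_lift).memLp_of_hasCompactSupport
      (HasCompactSupport.of_compactSpace _)
  rw [testCoeff_eq (ha.mul hφ).2, testCoeff_eq ha.2, testCoeff_eq hφ.2]
  funext k
  rw [← fourierCoeff_mul (hm ha) (hm hφ)]
  congr 1
  funext x
  rw [← Complex.ofReal_mul]
  congr 1
  induction x using QuotientAddGroup.induction_on with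
  | H x => simp only [Function.Periodic.lift_coe]

lemma norm_conv_rapidDecay_le {b : ℤ → ℂ} (hb : RapidDecay b) (u : L2) :
    ∃ C, ∀ k, ‖conv b (coeff u) k‖ ≤ C := by
  refine ⟨‖mulOp hb 0 (toSeq u)‖, fun k => ?_⟩
  have := (mulOp hb 0 (toSeq u)).norm_apply_le k
  rwa [coe_mulOp, neg_zero, wt_zero, wt_zero, coe_toSeq] at this

/-- The damping term, tested against a smooth function. -/
lemma hasSum_damping {a : ℝ → ℝ} (ha : IsSmoothPeriodic a) (u : L2) {φ : ℝ → ℝ}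
    (hφ : IsSmoothPeriodic φ) :
    HasSum (fun k => 2 * Real.pi *
        (testCoeff φ k * ((jap 2 k : ℂ) * dampSeq (testCoeff a) (coeff u) (-k))))
      ((mulSmooth a (helmholtz (mulSmooth a (ofFun u))) φ : ℝ) : ℂ) := by
  obtain ⟨hint, hco⟩ := memLp_lift_mul ha u
  have h1 := hasSum_helmholtz hint (ha.mul hφ)
  have h2 : mulSmooth a (ofFun u) = ofFun (fun x => ha.2.lift x * u x) := by
    funext φ
    simp only [mulSmooth, ofFun, Function.Periodic.lift_coe]
    congr 1; funext x; ring
  have hpi : (2 * Real.pi : ℂ) ≠ 0 := by simp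
  have hrb := rapidDecay_testCoeff ha
  obtain ⟨C, hC⟩ := norm_conv_rapidDecay_le hrb u
  rw [hco, testCoeff_mul ha hφ] at h1
  have h3 := h1.mul_left (2 * Real.pi : ℂ)⁻¹
  simp only [← mul_assoc, inv_mul_cancel₀ hpi, one_mul] at h3
  have h4 := hasSum_conv_transpose hrb (rapidDecay_testCoeff hφ)
    (g := wt 2 (conv (testCoeff a) (coeff u))) (C := C) (fun k => by
      rw [norm_wt, mul_comm]
      exact mul_le_mul_of_nonneg_right (hC k) (jap_pos _ k).le)
    (h3.congr_fun fun l => by rw [wt, jap_neg_arg, mul_assoc])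
  have h5 := h4.mul_left (2 * Real.pi : ℂ)
  simp only [← mul_assoc, mul_inv_cancel₀ hpi, one_mul] at h5
  change HasSum _ ((helmholtz (mulSmooth a (ofFun u)) (fun x => a x * φ x) : ℝ) : ℂ)
  rw [h2]
  refine h5.congr_fun fun k => ?_
  rw [dampSeq, wt, jap_neg_arg, ← mul_assoc (jap 2 k : ℂ), ← Complex.ofReal_mul, jap_mul_neg]
  push_cast; ring

/-- The time derivative of the Fourier coefficients prescribed by the equation. -/
def velocity (c : ℝ) (b f : ℤ → ℂ) (k : ℤ) : ℂ :=
  Complex.I * phase c k * f k - dampSeq b f k + quadSeq f f k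

/-- The spatial part is -(1 - ∂²) applied to the velocity, since (1 + k²)(c + 1/(1 + k²)) = ck² + c
+ 1. Frequencies k and -k are matched because the pairing involves no conjugation. -/
lemma hasSum_spatialPart (c : ℝ) {a : ℝ → ℝ} (ha : IsSmoothPeriodic a) (u : L2) {φ : ℝ → ℝ}
    (hφ : IsSmoothPeriodic φ) :
    HasSum (fun k => -(2 * Real.pi *
        (testCoeff φ k * ((jap 2 k : ℂ) * velocity c (testCoeff a) (coeff u) (-k)))))
      ((spatialPart c a u φ : ℝ) : ℂ) := by
  have h1 := (hasSum_ofFun (integrable_coe u) hφ.deriv.deriv.deriv).mul_left (c : ℂ)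
  have h2 := (hasSum_ofFun (integrable_coe u) hφ.deriv).mul_left (-(c + 1) : ℂ)
  have h3 := (hasSum_ofFun (integrable_sq u) hφ.deriv).mul_left (-1 : ℂ)
  have h4 := hasSum_damping ha u hφ
  have hsq : fourierCoeff (fun x => (((u x : ℝ) ^ 2 / 2 : ℝ) : ℂ))
      = fun k => conv (coeff u) (coeff u) k / 2 := by
    funext k
    have := fourierCoeff_mul (memLp_coe u) (memLp_coe u) k
    have h5 := fourierCoeff.const_mul (fun x => ((u x : ℝ) : ℂ) * ((u x : ℝ) : ℂ)) (1 / 2) k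
    rw [this] at h5
    rw [div_eq_inv_mul, ← one_div]
    refine Eq.trans ?_ h5
    congr 1
    funext x
    push_cast; ring
  have h5 := ((h1.add h2).add h3).add h4
  have hval : ((spatialPart c a u φ : ℝ) : ℂ)
      = c * ((ofFun u (deriv (deriv (deriv φ))) : ℝ) : ℂ)
        + -(c + 1) * ((ofFun u (deriv φ) : ℝ) : ℂ)
        + -1 * ((ofFun (fun x => (u x : ℝ) ^ 2 / 2) (deriv φ) : ℝ) : ℂ)
        + ((mulSmooth a (helmholtz (mulSmooth a (ofFun u))) φ : ℝ) : ℂ) := by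
    simp [spatialPart, ddx]
    ring
  rw [hval]
  refine h5.congr_fun fun k => ?_
  rw [testCoeff_deriv hφ.deriv.deriv, testCoeff_deriv hφ.deriv, testCoeff_deriv hφ, hsq]
  have e1 : (jap 2 k : ℂ) * quadSeq (coeff u) (coeff u) (-k)
      = Complex.I * k / 2 * conv (coeff u) (coeff u) (-k) := by
    have : (jap 2 k : ℂ) * (jap (-2) k : ℂ) = 1 := by
      rw [← Complex.ofReal_mul, jap_mul_neg, Complex.ofReal_one]
    rw [quadSeq, quadSymbol, jap_neg_arg]
    push_cast
    linear_combination (Complex.I * k / 2 * conv (coeff u) (coeff u) (-k)) * this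
  have e2 : (jap 2 k : ℂ) * phase c (-k) = k * (c * k ^ 2 + c + 1) := by
    rw [← Complex.ofReal_mul, phase_neg, phase, jap_two]
    have : (1 + (k : ℝ) ^ 2) ≠ 0 := (base_pos k).ne'
    have e3 : (1 + (k : ℝ) ^ 2) * -(-(k * (c + 1 / (1 + (k : ℝ) ^ 2))))
        = k * (c * k ^ 2 + c + 1) := by field_simp; ring
    rw [e3]; push_cast; ring
  simp only [velocity]
  change _ = _ + _ * (_ * (_ * coeff u (-k))) + _ + _
  change _ = (c : ℂ) * (_ * (_ * coeff u (-k))) + _ + _ + _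
  linear_combination (-2 * Real.pi * testCoeff φ k) * e1
    - (2 * Real.pi * testCoeff φ k * Complex.I * coeff u (-k)) * e2
    + (-2 * Real.pi * testCoeff φ k * Complex.I * c * k ^ 3 * coeff u (-k)) * Complex.I_sq

/-! ### Weak derivatives in time -/

/-- Test functions on `(0, T)`. -/
structure IsTimeTest (T : ℝ) (ψ : ℝ → ℝ) : Prop where
  contDiff : ContDiff ℝ ∞ ψ
  hasCompactSupport : HasCompactSupport ψ
  tsupport_subset : tsupport ψ ⊆ Set.Ioo 0 T

lemma IsTimeTest.apply_eq_zero {T : ℝ} {ψ : ℝ → ℝ} (h : IsTimeTest T ψ) {t : ℝ}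
    (ht : t ∉ Set.Ioo 0 T) : ψ t = 0 :=
  image_eq_zero_of_notMem_tsupport fun h' => ht (h.tsupport_subset h')

lemma IsTimeTest.support_subset {T : ℝ} {ψ : ℝ → ℝ} (h : IsTimeTest T ψ) :
    Function.support ψ ⊆ Set.Ioo 0 T :=
  (subset_tsupport ψ).trans h.tsupport_subset

lemma IsTimeTest.continuous_deriv {T : ℝ} {ψ : ℝ → ℝ} (h : IsTimeTest T ψ) :
    Continuous (deriv ψ) := (contDiff_infty_iff_deriv.mp h.contDiff).2.continuous

lemma integral_timeTest_eq_zero {T : ℝ} (hT : 0 ≤ T) {f h : ℝ → ℂ}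
    (hh : ContinuousOn h (Set.Icc 0 T))
    (hf : ∀ t ∈ Set.Icc 0 T, HasDerivWithinAt f (h t) (Set.Icc 0 T) t) {ψ : ℝ → ℝ}
    (hψ : IsTimeTest T ψ) :
    ∫ t in (0 : ℝ)..T, (((deriv ψ t : ℝ) : ℂ) * f t + ψ t * h t) = 0 := by
  have hfc : ContinuousOn f (Set.Icc 0 T) := fun t ht => (hf t ht).continuousWithinAt
  have hψc : Continuous fun t => ((ψ t : ℝ) : ℂ) :=
    Complex.continuous_ofReal.comp hψ.contDiff.continuous
  have hψc' : Continuous fun t => ((deriv ψ t : ℝ) : ℂ) :=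
    Complex.continuous_ofReal.comp hψ.continuous_deriv
  have hψd : ∀ t, HasDerivAt (fun t => ((ψ t : ℝ) : ℂ)) ((deriv ψ t : ℝ) : ℂ) t := fun t =>
    ((hψ.contDiff.differentiable (by simp)).differentiableAt.hasDerivAt).ofReal_comp
  rw [intervalIntegral.integral_eq_sub_of_hasDerivAt_of_le (f := fun t => (ψ t : ℂ) * f t) hT
    (hψc.continuousOn.mul hfc)
    (fun t ht => (hψd t).mul
      ((hf t (Set.Ioo_subset_Icc_self ht)).hasDerivAt (Icc_mem_nhds ht.1 ht.2)))
    (ContinuousOn.intervalIntegrable_of_Icc hT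
      ((hψc'.continuousOn.mul hfc).add (hψc.continuousOn.mul hh)))]
  rw [hψ.apply_eq_zero (t := 0) (by simp), hψ.apply_eq_zero (t := T) (by simp)]
  simp

lemma exists_primitive {E : Type*} [NormedAddCommGroup E] [NormedSpace ℝ E] [CompleteSpace E]
    {T : ℝ} (hT : 0 ≤ T) {w : ℝ → E} (hw : ContinuousOn w (Set.Icc 0 T)) (x₀ : E) :
    ∃ W : ℝ → E, W 0 = x₀ ∧ ∀ t ∈ Set.Icc 0 T, HasDerivWithinAt W (w t) (Set.Icc 0 T) t := by
  set w' : ℝ → E := fun t => w (Set.projIcc 0 T hT t) with hw'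
  have hc : Continuous w' := hw.comp_continuous
    (continuous_subtype_val.comp continuous_projIcc) fun t => (Set.projIcc 0 T hT t).2
  refine ⟨fun t => x₀ + ∫ τ in (0 : ℝ)..t, w' τ, by simp, fun t ht => ?_⟩
  have h1 := (intervalIntegral.integral_hasDerivAt_right (hc.intervalIntegrable 0 t)
    (hc.stronglyMeasurableAtFilter _ _) hc.continuousAt).const_add x₀
  have h2 : w' t = w t := by rw [hw']; simp only; rw [Set.projIcc_of_mem hT ht]
  rw [h2] at h1
  exact h1.hasDerivWithinAt

lemma eqOn_of_hasDerivWithinAt {E : Type*} [NormedAddCommGroup E] [NormedSpace ℝ E] {T : ℝ}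
    {f g h : ℝ → E} (hf : ∀ t ∈ Set.Icc 0 T, HasDerivWithinAt f (h t) (Set.Icc 0 T) t)
    (hg : ∀ t ∈ Set.Icc 0 T, HasDerivWithinAt g (h t) (Set.Icc 0 T) t) (h0 : f 0 = g 0) :
    Set.EqOn f g (Set.Icc 0 T) := by
  have hd : ∀ t ∈ Set.Icc 0 T, HasDerivWithinAt (f - g) 0 (Set.Icc 0 T) t := fun t ht => by
    simpa using (hf t ht).sub (hg t ht)
  intro t ht
  have := constant_of_has_deriv_right_zero (fun t ht => (hd t ht).continuousWithinAt)
    (fun t ht => hasDerivWithinAt_Ici_of_Icc ht (hd t (Set.Ico_subset_Icc_self ht))) t ht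
  simp only [Pi.sub_apply, h0, sub_self] at this
  exact sub_eq_zero.mp this

/-- A function of vanishing mean has a primitive among the test functions. -/
lemma exists_timeTest_primitive {T : ℝ} (hT : 0 < T) {ρ : ℝ → ℝ} (hρ : IsTimeTest T ρ)
    (hint : ∫ t, ρ t = 0) : ∃ ψ, IsTimeTest T ψ ∧ deriv ψ = ρ := by
  have hc := hρ.contDiff.continuous
  -- The point T/2 keeps the set nonempty when ρ = 0, so that it has least and greatest elements.
  have hcomp : IsCompact (insert (T / 2) (tsupport ρ)) := hρ.hasCompactSupport.isCompact.insert _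
  have hsub : insert (T / 2) (tsupport ρ) ⊆ Set.Ioo 0 T :=
    Set.insert_subset ⟨by linarith, by linarith⟩ hρ.tsupport_subset
  obtain ⟨α, hα, hα'⟩ := hcomp.exists_isLeast (Set.insert_nonempty _ _)
  obtain ⟨β, hβ, hβ'⟩ := hcomp.exists_isGreatest (Set.insert_nonempty _ _)
  have hK : ∀ x, x ∉ Set.Icc α β → ρ x = 0 := fun x hx =>
    image_eq_zero_of_notMem_tsupport fun h =>
      hx ⟨hα' (Set.mem_insert_of_mem _ h), hβ' (Set.mem_insert_of_mem _ h)⟩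
  set ψ : ℝ → ℝ := fun t => ∫ τ in (0 : ℝ)..t, ρ τ with hψ
  have hd : ∀ t, HasDerivAt ψ (ρ t) t := fun t =>
    intervalIntegral.integral_hasDerivAt_right (hc.intervalIntegrable 0 t)
      (hc.stronglyMeasurableAtFilter _ _) hc.continuousAt
  have hderiv : deriv ψ = ρ := funext fun t => (hd t).deriv
  have hsupp : tsupport ψ ⊆ Set.Icc α β := by
    refine closure_minimal (fun t ht => ?_) isClosed_Icc
    by_contra hn
    refine ht ?_
    rcases lt_or_ge t α with h | h
    · refine (intervalIntegral.integral_congr (g := fun _ => (0 : ℝ)) fun x hx => ?_).trans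
        (by simp)
      refine hK x fun hx' => ?_
      have h1 := (hsub hα).1
      rcases le_total 0 t with h0 | h0
      · rw [Set.uIcc_of_le h0] at hx; linarith [hx.2, hx'.1]
      · rw [Set.uIcc_of_ge h0] at hx; linarith [hx.2, hx'.1]
    · have hb : β < t := by
        by_contra hb
        exact hn ⟨h, not_lt.mp hb⟩
      refine Eq.trans ?_ hint
      refine intervalIntegral.integral_eq_integral_of_support_subset fun x hx => ?_
      have hx' : x ∈ Set.Icc α β := by
        by_contra h'
        exact hx (hK x h')
      exact ⟨(hsub hα).1.trans_le hx'.1, hx'.2.trans hb.le⟩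
  refine ⟨ψ, ⟨?_, ?_, ?_⟩, hderiv⟩
  · rw [contDiff_infty_iff_deriv, hderiv]
    exact ⟨fun t => (hd t).differentiableAt, hρ.contDiff⟩
  · exact HasCompactSupport.of_support_subset_isCompact isCompact_Icc
      ((subset_tsupport ψ).trans hsupp)
  · exact hsupp.trans fun t ht => ⟨(hsub hα).1.trans_le ht.1, ht.2.trans_lt (hsub hβ).2⟩

lemma exists_timeTest_integral_eq_one {T : ℝ} (hT : 0 < T) :
    ∃ η, IsTimeTest T η ∧ ∫ t, η t = 1 := by
  let B : ContDiffBump (T / 2) :=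
    { rIn := T / 8, rOut := T / 4, rIn_pos := by positivity, rIn_lt_rOut := by linarith }
  refine ⟨B.normed volume, ⟨B.contDiff_normed, B.hasCompactSupport_normed, ?_⟩,
    B.integral_normed⟩
  rw [B.tsupport_normed_eq, Real.closedBall_eq_Icc]
  intro t ht
  have h1 : T / 2 - T / 4 ≤ t := ht.1
  have h2 : t ≤ T / 2 + T / 4 := ht.2
  exact ⟨by linarith, by linarith⟩

lemma IsTimeTest.sub_smul {T : ℝ} {θ η : ℝ → ℝ} (hθ : IsTimeTest T θ) (hη : IsTimeTest T η)
    (r : ℝ) : IsTimeTest T (fun t => θ t - r * η t) := by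
  have hsupp : tsupport (fun t => θ t - r * η t) ⊆ tsupport θ ∪ tsupport η := by
    refine closure_minimal (fun t ht => ?_)
      ((isClosed_tsupport θ).union (isClosed_tsupport η))
    by_contra hn
    rw [Set.mem_union, not_or] at hn
    refine ht ?_
    simp [image_eq_zero_of_notMem_tsupport hn.1, image_eq_zero_of_notMem_tsupport hn.2]
  refine ⟨hθ.contDiff.sub (contDiff_const.mul hη.contDiff), ?_,
    hsupp.trans (Set.union_subset hθ.tsupport_subset hη.tsupport_subset)⟩
  exact HasCompactSupport.of_support_subset_isCompact
    (hθ.hasCompactSupport.isCompact.union hη.hasCompactSupport.isCompact)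
    ((subset_tsupport _).trans hsupp)

lemma IsTimeTest.integral_eq {T : ℝ} {ψ : ℝ → ℝ} (hψ : IsTimeTest T ψ) (G : ℝ → ℂ) :
    ∫ t in (0 : ℝ)..T, (ψ t : ℂ) * G t = ∫ t, ψ t • G t := by
  simp only [← Complex.real_smul]
  refine intervalIntegral.integral_eq_integral_of_support_subset fun t ht => ?_
  refine Set.Ioo_subset_Ioc_self (hψ.support_subset fun h => ht ?_)
  simp only [h, zero_smul]

/-- The lemma of du Bois-Reymond. -/
lemma eqOn_const_of_integral_deriv_timeTest {T : ℝ} (hT : 0 < T) {G : ℝ → ℂ}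
    (hG : ContinuousOn G (Set.Icc 0 T))
    (h : ∀ ψ, IsTimeTest T ψ → ∫ t in (0 : ℝ)..T, ((deriv ψ t : ℝ) : ℂ) * G t = 0) :
    ∃ C : ℂ, ∀ t ∈ Set.Icc 0 T, G t = C := by
  obtain ⟨η, hη, hη1⟩ := exists_timeTest_integral_eq_one hT
  set C := ∫ t in (0 : ℝ)..T, (η t : ℂ) * G t with hC
  have hii : ∀ θ, IsTimeTest T θ →
      IntervalIntegrable (fun t => (θ t : ℂ) * G t) volume 0 T := fun θ hθ =>
    ContinuousOn.intervalIntegrable_of_Icc hT.le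
      ((Complex.continuous_ofReal.comp hθ.contDiff.continuous).continuousOn.mul hG)
  have hi : ∀ θ, IsTimeTest T θ → Integrable θ := fun θ hθ =>
    hθ.contDiff.continuous.integrable_of_hasCompactSupport hθ.hasCompactSupport
  -- Subtracting from θ its integral times η leaves a function of mean zero, which is the derivative
  -- of a test function.
  have key : ∀ θ, IsTimeTest T θ → ∫ t, θ t • (G t - C) = 0 := fun θ hθ => by
    set r := ∫ t, θ t with hr
    have hρ := hθ.sub_smul hη r
    have hρ0 : ∫ t, (θ t - r * η t) = 0 := by
      rw [integral_sub (hi θ hθ) ((hi η hη).const_mul r), integral_const_mul, hη1, mul_one, hr,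
        sub_self]
    obtain ⟨ψ, hψ, hψd⟩ := exists_timeTest_primitive hT hρ hρ0
    have h1 := h ψ hψ
    rw [hψd] at h1
    have h2 : ∫ t in (0 : ℝ)..T, (((θ t - r * η t : ℝ)) : ℂ) * G t
        = (∫ t in (0 : ℝ)..T, (θ t : ℂ) * G t) - r * C := by
      rw [hC, ← intervalIntegral.integral_const_mul,
        ← intervalIntegral.integral_sub (hii θ hθ) ((hii η hη).const_mul _)]
      congr 1
      funext t
      push_cast; ring
    rw [h2] at h1
    rw [← hθ.integral_eq]
    have h3 : ∫ t in (0 : ℝ)..T, (θ t : ℂ) * C = r * C := by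
      rw [hθ.integral_eq (fun _ => C), integral_smul_const, hr, Complex.real_smul]
    simp only [mul_sub]
    rw [intervalIntegral.integral_sub (hii θ hθ)
      (show IntervalIntegrable (fun t => (θ t : ℂ) * C) volume 0 T from
        ((Complex.continuous_ofReal.comp hθ.contDiff.continuous).mul
          continuous_const).intervalIntegrable _ _), h3, h1]
  have hcont : ContinuousOn (fun t => G t - C) (Set.Icc 0 T) := hG.sub continuousOn_const
  have hae := isOpen_Ioo.ae_eq_zero_of_integral_contDiff_smul_eq_zero (μ := volume)
    (f := fun t => G t - C) (U := Set.Ioo 0 T)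
    ((hcont.mono Set.Ioo_subset_Icc_self).locallyIntegrableOn measurableSet_Ioo)
    (fun θ h1 h2 h3 => key θ ⟨h1, h2, h3⟩)
  have hae' : G =ᵐ[volume.restrict (Set.Icc 0 T)] fun _ => C := by
    rw [← restrict_Ioo_eq_restrict_Icc]
    rw [EventuallyEq, ae_restrict_iff' measurableSet_Ioo]
    filter_upwards [hae] with t ht ht'
    exact sub_eq_zero.mp (ht ht')
  exact ⟨C, Measure.eqOn_Icc_of_ae_eq volume hT.ne hae' hG continuousOn_const⟩

/-- Continuous functions with a continuous weak derivative are differentiable. -/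
lemma hasDerivWithinAt_of_weak {T : ℝ} (hT : 0 < T) {f h : ℝ → ℂ}
    (hf : ContinuousOn f (Set.Icc 0 T)) (hh : ContinuousOn h (Set.Icc 0 T))
    (hweak : ∀ ψ, IsTimeTest T ψ →
      ∫ t in (0 : ℝ)..T, (((deriv ψ t : ℝ) : ℂ) * f t + ψ t * h t) = 0) :
    ∀ t ∈ Set.Icc 0 T, HasDerivWithinAt f (h t) (Set.Icc 0 T) t := by
  obtain ⟨H, -, hH⟩ := exists_primitive hT.le hh 0
  have hHc : ContinuousOn H (Set.Icc 0 T) := fun t ht => (hH t ht).continuousWithinAt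
  -- The function f and the primitive H of h have the same weak derivative, so they differ by a
  -- constant.
  obtain ⟨C, hC⟩ := eqOn_const_of_integral_deriv_timeTest hT (hf.sub hHc) fun ψ hψ => by
    have h1 := hweak ψ hψ
    have h2 := integral_timeTest_eq_zero hT.le hh hH hψ
    have hc1 : Continuous fun t => ((ψ t : ℝ) : ℂ) :=
      Complex.continuous_ofReal.comp hψ.contDiff.continuous
    have hc2 : Continuous fun t => ((deriv ψ t : ℝ) : ℂ) :=
      Complex.continuous_ofReal.comp hψ.continuous_deriv
    rw [← sub_eq_zero.mpr (h1.trans h2.symm), ← intervalIntegral.integral_sub]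
    · congr 1
      funext t
      simp only [Pi.sub_apply]; ring
    · exact ContinuousOn.intervalIntegrable_of_Icc hT.le
        ((hc2.continuousOn.mul hf).add (hc1.continuousOn.mul hh))
    · exact ContinuousOn.intervalIntegrable_of_Icc hT.le
        ((hc2.continuousOn.mul hHc).add (hc1.continuousOn.mul hh))
  intro t ht
  refine ((hH t ht).const_add C).congr (fun τ hτ => ?_) ?_
  · have := hC τ hτ; simp only [Pi.sub_apply] at this; rw [← this]; ring
  · have := hC t ht; simp only [Pi.sub_apply] at this; rw [← this]; ring

/-- Evaluation of a sequence at an index. -/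
def Seq.eval (k : ℤ) : Seq →L[ℝ] ℂ :=
  ⟨{ toFun := fun f => f k, map_add' := fun _ _ => rfl, map_smul' := fun _ _ => rfl },
    Seq.continuous_eval k⟩

@[simp] lemma Seq.eval_apply (k : ℤ) (f : Seq) : Seq.eval k f = f k := rfl

/-- Curves in `Seq` can be differentiated entrywise when the derivative is continuous. -/
lemma hasDerivWithinAt_of_entries {T : ℝ} (hT : 0 ≤ T) {y w : ℝ → Seq}
    (hw : ContinuousOn w (Set.Icc 0 T))
    (h : ∀ k, ∀ t ∈ Set.Icc 0 T, HasDerivWithinAt (fun t => y t k) (w t k) (Set.Icc 0 T) t) :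
    ∀ t ∈ Set.Icc 0 T, HasDerivWithinAt y (w t) (Set.Icc 0 T) t := by
  -- The primitive of w in ℓ² is differentiable in norm and agrees with y entry by entry.
  obtain ⟨Y, hY0, hY⟩ := exists_primitive hT hw (y 0)
  have heq : Set.EqOn y Y (Set.Icc 0 T) := fun t ht => by
    apply Seq.ext
    funext k
    exact eqOn_of_hasDerivWithinAt (h k)
      (fun t ht => (Seq.eval k).hasFDerivAt.comp_hasDerivWithinAt t (hY t ht))
      (by simp [hY0]) ht
  exact fun t ht => (hY t ht).congr heq (heq ht)

/-! ### The equation for the Fourier coefficients -/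

/-- The damping and the nonlinearity, on sequences of Fourier coefficients. -/
def reaction {b : ℤ → ℂ} (hb : RapidDecay b) (f : Seq) : Seq :=
  -(damp hb 0 f) + quad 0 le_rfl f f

section

variable (c : ℝ) {b : ℤ → ℂ} (hb : RapidDecay b)

lemma velocity_eq (f : Seq) (k : ℤ) :
    velocity c b f k = Complex.I * phase c k * f k + reaction hb f k := by
  have h1 : (reaction hb f : ℤ → ℂ) k = -((damp hb 0 f : Seq) : ℤ → ℂ) k
      + ((quad 0 le_rfl f f : Seq) : ℤ → ℂ) k := rfl
  rw [h1, coe_damp, coe_quad, neg_zero, wt_zero, wt_zero, wt_zero, velocity]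
  ring

lemma continuousOn_reaction {x : ℝ → Seq} {S : Set ℝ} (hx : ContinuousOn x S) :
    ContinuousOn (fun t => reaction hb (x t)) S := by
  have h := continuousOn_linear_add_quadratic (A := fun _ => -damp hb 0) (quad 0 le_rfl)
    (β := fun _ => 1) continuousOn_const continuousOn_const hx
  refine h.congr fun t _ => ?_
  simp only [one_smul, neg_apply, reaction]

lemma kdvField_one (t : ℝ) (x : Seq) :
    kdvField c hb 0 le_rfl 1 1 t x = evol c (-t) (reaction hb (evol c t x)) := by
  simp only [kdvField, field, reaction, Pi.one_apply, one_smul, neg_apply]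

lemma continuousOn_velocity (c : ℝ) {b : ℤ → ℂ} (hb : RapidDecay b) {x : ℝ → Seq} {S : Set ℝ}
    (hx : ContinuousOn x S) (k : ℤ) :
    ContinuousOn (fun t => velocity c b (x t) k) S := by
  simp only [velocity_eq c hb]
  exact (continuousOn_const.mul ((Seq.continuous_eval k).comp_continuousOn hx)).add
    ((Seq.continuous_eval k).comp_continuousOn (continuousOn_reaction hb hx))

lemma abs_phase_le (k : ℤ) : |phase c k| ≤ (|c| + 1) * jap 1 k := by
  have h0 := base_pos k
  have h1 : |1 / (1 + (k : ℝ) ^ 2)| ≤ 1 := by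
    rw [abs_of_pos (by positivity), div_le_one h0]; exact one_le_base k
  rw [phase, abs_neg, abs_mul, mul_comm]
  exact mul_le_mul ((abs_add_le _ _).trans (by linarith)) (abs_le_jap_one k) (abs_nonneg _)
    (by positivity)

lemma norm_velocity_le (f : Seq) (k : ℤ) :
    ‖velocity c b f k‖ ≤ jap 1 k * ((|c| + 1) * ‖f‖ + ‖reaction hb f‖) := by
  rw [velocity_eq c hb]
  have h1 := one_le_jap zero_le_one k
  have h2 : ‖Complex.I * phase c k * f k‖ ≤ (|c| + 1) * jap 1 k * ‖f‖ := by
    rw [norm_mul, norm_mul, Complex.norm_I, one_mul, Complex.norm_real, Real.norm_eq_abs]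
    exact mul_le_mul (abs_phase_le c k) (f.norm_apply_le k) (norm_nonneg _)
      (mul_nonneg (by positivity) (jap_pos _ _).le)
  have h3 : ‖reaction hb f k‖ ≤ jap 1 k * ‖reaction hb f‖ :=
    ((reaction hb f).norm_apply_le k).trans (le_mul_of_one_le_left (norm_nonneg _) h1)
  refine (norm_add_le _ _).trans ((add_le_add h2 h3).trans_eq ?_)
  ring

lemma hasDerivAt_exp_phase (θ t : ℝ) :
    HasDerivAt (fun t : ℝ => Complex.exp ((t * θ : ℝ) * Complex.I))
      (Complex.exp ((t * θ : ℝ) * Complex.I) * (θ * Complex.I)) t := by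
  have h : HasDerivAt (fun t : ℝ => ((t * θ : ℝ) : ℂ)) (θ : ℂ) t := by
    simpa using ((hasDerivAt_id t).mul_const θ).ofReal_comp
  exact (h.mul_const Complex.I).cexp

/-- This is stated for each entry, where the group is a scalar exponential and the product rule
applies: the curve itself need not be differentiable in ℓ². -/
lemma SolvesODE.hasDerivWithinAt_evol {T : ℝ} {y : ℝ → Seq}
    (hy : SolvesODE (kdvField c hb 0 le_rfl 1 1) T y) (k : ℤ) (t : ℝ) (ht : t ∈ Set.Icc 0 T) :
    HasDerivWithinAt (fun t => evol c t (y t) k) (velocity c b (evol c t (y t)) k)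
      (Set.Icc 0 T) t := by
  have h1 := (Seq.eval k).hasFDerivAt.comp_hasDerivWithinAt t (hy t ht)
  have h2 := (hasDerivAt_exp_phase (phase c k) t).hasDerivWithinAt.mul h1
  refine h2.congr_deriv ?_
  have h3 : evol c t (evol c (-t) (reaction hb (evol c t (y t)))) k
      = reaction hb (evol c t (y t)) k := by rw [evol_evol_neg]
  rw [velocity_eq c hb, ← h3, kdvField_one, evol_apply c t (y t),
    evol_apply c t (evol c (-t) _)]
  simp only [Function.comp_apply, Seq.eval_apply]
  ring

/-- Undoing the phases cancels the unbounded term. The remaining derivative is continuous in ℓ², so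
the entrywise derivatives assemble into one in ℓ². -/
lemma solvesODE_of_hasDerivWithinAt {T : ℝ} (hT : 0 ≤ T) {U : ℝ → Seq}
    (hU : ContinuousOn U (Set.Icc 0 T))
    (h : ∀ k, ∀ t ∈ Set.Icc 0 T,
      HasDerivWithinAt (fun t => U t k) (velocity c b (U t) k) (Set.Icc 0 T) t) :
    SolvesODE (kdvField c hb 0 le_rfl 1 1) T (fun t => evol c (-t) (U t)) := by
  have hw : ContinuousOn (fun t => evol c (-t) (reaction hb (U t))) (Set.Icc 0 T) :=
    continuousOn_evol c continuousOn_neg (continuousOn_reaction hb hU)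
  intro t ht
  rw [kdvField_one, evol_evol_neg]
  refine hasDerivWithinAt_of_entries hT hw (fun k t ht => ?_) t ht
  have h1 := ((hasDerivAt_exp_phase (-phase c k) t).hasDerivWithinAt.mul (h k t ht))
  have h2 : ∀ (t : ℝ) (f : Seq), evol c (-t) f k
      = Complex.exp ((t * -phase c k : ℝ) * Complex.I) * f k := fun t f => by
    rw [evol_apply, neg_mul, mul_neg]
  simp only [h2]
  refine h1.congr_deriv ?_
  rw [velocity_eq c hb]
  push_cast; ring

end

/-! ### The distributional formulation -/

/-- The numbers p and q stand for ψ'(t) and ψ(t). Factoring out the symbol of 1 - ∂² leaves the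
integrand of the weak equation of a single coefficient. -/
lemma hasSum_integrand (c : ℝ) {a : ℝ → ℝ} (ha : IsSmoothPeriodic a) (u : L2) {φ : ℝ → ℝ}
    (hφ : IsSmoothPeriodic φ) (p q : ℝ) :
    HasSum (fun k => testCoeff φ k * (-(2 * Real.pi * (jap 2 k : ℂ)) *
        (p * toSeq u (-k) + q * velocity c (testCoeff a) (toSeq u) (-k))))
      ((-p * helmholtz (ofFun u) φ + q * spatialPart c a u φ : ℝ) : ℂ) := by
  have h1 := (hasSum_helmholtz (integrable_coe u) hφ).mul_left (-p : ℂ)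
  have h2 := (hasSum_spatialPart c ha u hφ).mul_left (q : ℂ)
  push_cast
  refine (h1.add h2).congr_fun fun k => ?_
  rw [coe_toSeq]
  change _ = -(p : ℂ) * (_ * (_ * (_ * coeff u (-k)))) + _
  ring

lemma isSmoothPeriodic_comp_int_mul {f : ℝ → ℝ} (hf : ContDiff ℝ ∞ f)
    (hper : Function.Periodic f (2 * Real.pi)) (m : ℤ) :
    IsSmoothPeriodic (fun x => f (m * x)) := by
  refine ⟨hf.comp (contDiff_const.mul contDiff_id), fun x => ?_⟩
  simp only
  rw [mul_add]
  exact hper.int_mul m _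

/-- The exponentials, as a combination of two real test functions. -/
lemma exists_testCoeff_eq_single (m : ℤ) :
    ∃ φ₁ φ₂, IsSmoothPeriodic φ₁ ∧ IsSmoothPeriodic φ₂ ∧
      ∀ k, testCoeff φ₁ k + Complex.I * testCoeff φ₂ k = if k = m then 1 else 0 := by
  have h1 := isSmoothPeriodic_comp_int_mul Real.contDiff_cos Real.cos_periodic m
  have h2 := isSmoothPeriodic_comp_int_mul Real.contDiff_sin Real.sin_periodic m
  refine ⟨_, _, h1, h2, fun k => ?_⟩
  have hi : ∀ {φ : ℝ → ℝ} (hφ : IsSmoothPeriodic φ),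
      Integrable (fun x : Torus => ((hφ.2.lift x : ℝ) : ℂ)) haar := fun hφ =>
    (Complex.continuous_ofReal.comp hφ.continuous_lift).integrable_of_hasCompactSupport
      (HasCompactSupport.of_compactSpace _)
  have h3 := congrFun (fourierCoeff.add (hi h1) ((hi h2).const_mul Complex.I)) k
  rw [Pi.add_apply, fourierCoeff.const_mul] at h3
  rw [testCoeff_eq h1.2, testCoeff_eq h2.2, ← h3, ← Pi.single_apply,
    ← fourierCoeff_fourier (T := 2 * Real.pi) m]
  congr 1
  funext x
  induction x using QuotientAddGroup.induction_on with
  | H x =>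
    have h4 := fourier_coe_apply (T := 2 * Real.pi) (n := m) (x := x)
    have h5 : 2 * Real.pi * Complex.I * m * x / ((2 * Real.pi : ℝ) : ℂ)
        = ((m * x : ℝ) : ℂ) * Complex.I := by
      have : (Real.pi : ℂ) ≠ 0 := by exact_mod_cast Real.pi_ne_zero
      push_cast
      field_simp
    rw [h5, Complex.exp_mul_I] at h4
    refine Eq.trans ?_ h4.symm
    simp only [Pi.add_apply, Function.Periodic.lift_coe]
    push_cast
    ring

lemma continuousOn_timeTest_mul (c : ℝ) {a : ℝ → ℝ} (ha : IsSmoothPeriodic a) {T : ℝ} {u : ℝ → L2}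
    (hu : ContinuousOn (fun t => toSeq (u t)) (Set.Icc 0 T))
    {ψ : ℝ → ℝ} (hψ : IsTimeTest T ψ) (k : ℤ) :
    ContinuousOn (fun t => ((deriv ψ t : ℝ) : ℂ) * toSeq (u t) k
      + ψ t * velocity c (testCoeff a) (toSeq (u t)) k) (Set.Icc 0 T) :=
  ((Complex.continuous_ofReal.comp hψ.continuous_deriv).continuousOn.mul
    ((Seq.continuous_eval k).comp_continuousOn hu)).add
  ((Complex.continuous_ofReal.comp hψ.contDiff.continuous).continuousOn.mul
    (continuousOn_velocity c (rapidDecay_testCoeff ha) hu k))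

lemma SolvesEquation.hasDerivWithinAt (c : ℝ) {a : ℝ → ℝ} (ha : IsSmoothPeriodic a) {T : ℝ}
    (hT : 0 < T) {u : ℝ → L2}
    (hu : ContinuousOn (fun t => toSeq (u t)) (Set.Icc 0 T))
    (h : SolvesEquation c a T u) (k : ℤ) :
    ∀ t ∈ Set.Icc 0 T, HasDerivWithinAt (fun t => toSeq (u t) k)
      (velocity c (testCoeff a) (toSeq (u t)) k) (Set.Icc 0 T) t := by
  obtain ⟨φ₁, φ₂, hφ₁, hφ₂, hφ⟩ := exists_testCoeff_eq_single (-k)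
  refine hasDerivWithinAt_of_weak hT ((Seq.continuous_eval k).comp_continuousOn hu)
    (continuousOn_velocity c (rapidDecay_testCoeff ha) hu k) fun ψ hψ => ?_
  have hcont := continuousOn_timeTest_mul c ha hu hψ k
  set G : ℝ → ℂ := fun t => ((deriv ψ t : ℝ) : ℂ) * toSeq (u t) k
      + ψ t * velocity c (testCoeff a) (toSeq (u t)) k with hG
  set κ : ℂ := -(2 * Real.pi * (jap 2 k : ℂ)) with hκ
  have hκ0 : κ ≠ 0 := by
    have := (jap_pos 2 k).ne'
    simp [hκ, this]
  set F : (ℝ → ℝ) → ℝ → ℝ := fun φ t =>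
    -(deriv ψ t) * helmholtz (ofFun (u t)) φ + ψ t * spatialPart c a (u t) φ with hF
  -- Only the mode -k of the combined test function survives, and it pairs with the coefficient k.
  -- As F is real, both tested equations can be read off as real and imaginary parts.
  have key : ∀ t, κ * G t = F φ₁ t + Complex.I * F φ₂ t := fun t => by
    have h1 := hasSum_integrand c ha (u t) hφ₁ (deriv ψ t) (ψ t)
    have h2 := (hasSum_integrand c ha (u t) hφ₂ (deriv ψ t) (ψ t)).mul_left Complex.I
    have h3 := h1.add h2
    simp only [← mul_assoc, ← add_mul] at h3
    simp only [hφ] at h3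
    refine (hasSum_single (-k) fun j hj => ?_).unique h3 |>.symm.trans ?_ |>.symm
    · simp [hj]
    · simp only [if_true, one_mul, neg_neg, jap_neg_arg, hκ, hG]
  have hint : IntervalIntegrable (fun t => κ * G t) volume 0 T :=
    ContinuousOn.intervalIntegrable_of_Icc hT.le (continuousOn_const.mul hcont)
  have hre : ∀ t, (κ * G t).re = F φ₁ t := fun t => by rw [key]; simp
  have him : ∀ t, (κ * G t).im = F φ₂ t := fun t => by rw [key]; simp
  have h0 : ∫ t in (0 : ℝ)..T, κ * G t = 0 := by
    apply Complex.ext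
    · have := Complex.reCLM.intervalIntegral_comp_comm hint
      simp only [Complex.reCLM_apply, hre] at this
      rw [← this]
      exact h ψ hψ.contDiff hψ.hasCompactSupport hψ.tsupport_subset φ₁ hφ₁
    · have := Complex.imCLM.intervalIntegral_comp_comm hint
      simp only [Complex.imCLM_apply, him] at this
      rw [← this]
      exact h ψ hψ.contDiff hψ.hasCompactSupport hψ.tsupport_subset φ₂ hφ₂
  rw [intervalIntegral.integral_const_mul] at h0
  exact (mul_eq_zero.mp h0).resolve_left hκ0

/-- Each mode integrates to zero by parts in time, and dominated convergence permits integrating the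
Fourier series of the integrand term by term. -/
lemma solvesEquation_of_hasDerivWithinAt (c : ℝ) {a : ℝ → ℝ} (ha : IsSmoothPeriodic a) {T : ℝ}
    (hT : 0 < T) {u : ℝ → L2}
    (hu : ContinuousOn (fun t => toSeq (u t)) (Set.Icc 0 T))
    (h : ∀ k, ∀ t ∈ Set.Icc 0 T, HasDerivWithinAt (fun t => toSeq (u t) k)
      (velocity c (testCoeff a) (toSeq (u t)) k) (Set.Icc 0 T) t) :
    SolvesEquation c a T u := by
  intro ψ h1 h2 h3 φ hφ
  have hψ : IsTimeTest T ψ := ⟨h1, h2, h3⟩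
  have hb := rapidDecay_testCoeff ha
  set G : ℤ → ℝ → ℂ := fun k t => ((deriv ψ t : ℝ) : ℂ) * toSeq (u t) k
      + ψ t * velocity c (testCoeff a) (toSeq (u t)) k with hG
  have hGc : ∀ k, ContinuousOn (G k) (Set.Icc 0 T) := continuousOn_timeTest_mul c ha hu hψ
  have hG0 : ∀ k, ∫ t in (0 : ℝ)..T, G k t = 0 := fun k =>
    integral_timeTest_eq_zero hT.le (continuousOn_velocity c hb hu k) (h k) hψ
  have hN : ContinuousOn (fun t => |deriv ψ t| * ‖toSeq (u t)‖ + |ψ t| *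
      ((|c| + 1) * ‖toSeq (u t)‖ + ‖reaction hb (toSeq (u t))‖)) (Set.Icc 0 T) :=
    (hψ.continuous_deriv.abs.continuousOn.mul hu.norm).add
      (h1.continuous.abs.continuousOn.mul ((continuousOn_const.mul hu.norm).add
        (continuousOn_reaction hb hu).norm))
  obtain ⟨R, hR, hNR⟩ := exists_bound_of_continuousOn hN
  have hGR : ∀ k, ∀ t ∈ Set.Icc 0 T, ‖G k t‖ ≤ jap 1 k * R := fun k t ht => by
    refine le_trans ?_ (mul_le_mul_of_nonneg_left ((le_abs_self _).trans (hNR t ht))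
      (jap_pos 1 k).le)
    have e1 : ‖toSeq (u t) k‖ ≤ jap 1 k * ‖toSeq (u t)‖ :=
      ((toSeq (u t)).norm_apply_le k).trans
        (le_mul_of_one_le_left (norm_nonneg _) (one_le_jap zero_le_one k))
    have e2 := norm_velocity_le c hb (toSeq (u t)) k
    calc ‖G k t‖ ≤ |deriv ψ t| * ‖toSeq (u t) k‖
          + |ψ t| * ‖velocity c (testCoeff a) (toSeq (u t)) k‖ := by
          refine (norm_add_le _ _).trans_eq ?_
          rw [norm_mul, norm_mul, Complex.norm_real, Complex.norm_real, Real.norm_eq_abs,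
            Real.norm_eq_abs]
      _ ≤ |deriv ψ t| * (jap 1 k * ‖toSeq (u t)‖) + |ψ t| * (jap 1 k *
          ((|c| + 1) * ‖toSeq (u t)‖ + ‖reaction hb (toSeq (u t))‖)) := by gcongr
      _ = _ := by ring
  have hIoc : Set.uIoc 0 T ⊆ Set.Icc 0 T := by
    rw [Set.uIoc_of_le hT.le]; exact Set.Ioc_subset_Icc_self
  have hsum := intervalIntegral.hasSum_integral_of_dominated_convergence (μ := volume)
    (a := (0 : ℝ)) (b := T)
    (F := fun k t => testCoeff φ k * (-(2 * Real.pi * (jap 2 k : ℂ)) * G (-k) t))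
    (f := fun t => ((-(deriv ψ t) * helmholtz (ofFun (u t)) φ
      + ψ t * spatialPart c a (u t) φ : ℝ) : ℂ))
    -- Two orders come from 1 - ∂² and one from the linear growth of the phase.
    (fun k _ => 2 * Real.pi * R * (jap 3 k * ‖testCoeff φ k‖))
    (fun k => ?_) (fun k => Eventually.of_forall fun t ht => ?_)
    (Eventually.of_forall fun t _ => (rapidDecay_testCoeff hφ 3).mul_left _)
    intervalIntegrable_const
    (Eventually.of_forall fun t _ => hasSum_integrand c ha (u t) hφ (deriv ψ t) (ψ t))
  · simp only [intervalIntegral.integral_const_mul, hG0, mul_zero] at hsum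
    have := hsum.unique hasSum_zero
    rw [intervalIntegral.integral_ofReal] at this
    exact_mod_cast this
  · exact (continuousOn_const.mul (continuousOn_const.mul
      ((hGc (-k)).mono hIoc))).aestronglyMeasurable measurableSet_uIoc
  · have e1 := hGR (-k) t (hIoc ht)
    rw [jap_neg_arg] at e1
    have e2 : jap 3 k = jap 2 k * jap 1 k := by rw [← jap_add]; norm_num
    have e3 : ‖-(2 * Real.pi * (jap 2 k : ℂ))‖ = 2 * Real.pi * jap 2 k := by
      rw [norm_neg, norm_mul, norm_mul, Complex.norm_real, Complex.norm_real,
        Real.norm_of_nonneg Real.pi_pos.le, Real.norm_of_nonneg (jap_pos 2 k).le,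
        Complex.norm_ofNat]
    rw [norm_mul, norm_mul, e3]
    have := (jap_pos 2 k).le
    calc _ ≤ ‖testCoeff φ k‖ * (2 * Real.pi * jap 2 k * (jap 1 k * R)) := by gcongr
      _ = _ := by rw [e2]; ring

/-! ### Sobolev norms -/

lemma memSobolev_iff {s : ℝ} {u : L2} : MemSobolev s u ↔ Memℓp (wt s (coeff u)) 2 := by
  rw [memSeq_iff, MemSobolev]
  simp only [norm_wt, mul_pow, jap_sq]

lemma sobolevNorm_eq {s : ℝ} {u : L2} {f : Seq} (h : (f : ℤ → ℂ) = wt s (coeff u)) :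
    sobolevNorm s u = Real.sqrt (2 * Real.pi) * ‖f‖ := by
  have h1 : ∑' k : ℤ, (1 + (k : ℝ) ^ 2) ^ s * ‖coeff u k‖ ^ 2 = ‖f‖ ^ 2 := by
    rw [← f.hasSum_sq.tsum_eq]
    refine tsum_congr fun k => ?_
    rw [h, norm_wt, mul_pow, jap_sq]
  rw [sobolevNorm, h1, Real.sqrt_mul Real.two_pi_pos.le, Real.sqrt_sq (norm_nonneg _)]

lemma norm_toSeq_le {s : ℝ} (hs : 0 ≤ s) {u : L2} (hu : MemSobolev s u) :
    ‖toSeq u‖ ≤ sobolevNorm s u := by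
  rw [sobolevNorm_eq (f := Seq.mk _ (memSobolev_iff.mp hu)) rfl]
  refine (Seq.norm_le_of_le (g := Seq.mk _ (memSobolev_iff.mp hu)) zero_le_one
    fun k => ?_).trans (mul_le_mul_of_nonneg_right ?_ (norm_nonneg _))
  · rw [coe_toSeq, Seq.coe_mk, norm_wt, one_mul]
    exact le_mul_of_one_le_left (norm_nonneg _) (one_le_jap hs k)
  · rw [Real.one_le_sqrt]
    linarith [Real.pi_gt_three]

lemma MemSobolev.sub {s : ℝ} {u v : L2} (hu : MemSobolev s u) (hv : MemSobolev s v) :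
    MemSobolev s (u - v) := by
  rw [memSobolev_iff] at *
  convert hu.sub hv using 1
  funext k
  simp only [coeff_sub, wt, Pi.sub_apply, mul_sub]

lemma ContinuousInSobolev.continuousOn_toSeq {s : ℝ} (hs : 0 ≤ s) {T : ℝ} {u : ℝ → L2}
    (hu : ContinuousInSobolev s T u) : ContinuousOn (fun t => toSeq (u t)) (Set.Icc 0 T) := by
  intro t ht
  rw [ContinuousWithinAt, tendsto_iff_norm_sub_tendsto_zero]
  refine squeeze_zero' (Eventually.of_forall fun _ => norm_nonneg _) ?_ (hu.2 t ht)
  filter_upwards [self_mem_nhdsWithin] with τ hτ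
  rw [← toSeq_sub]
  exact norm_toSeq_le hs ((hu.1 τ hτ).sub (hu.1 t ht))

lemma continuousInSobolev_of_coeff_eq {s T : ℝ} {u : ℝ → L2} {Z : ℝ → Seq}
    (hZ : ContinuousOn Z (Set.Icc 0 T)) (h : ∀ t, coeff (u t) = wt (-s) (Z t)) :
    ContinuousInSobolev s T u := by
  refine ⟨fun t _ => ?_, fun t ht => ?_⟩
  · rw [memSobolev_iff, h, wt_wt_neg]
    exact memSeq_iff.mpr (Z t).summable_sq
  · have h1 : ∀ τ, sobolevNorm s (u τ - u t) = Real.sqrt (2 * Real.pi) * ‖Z τ - Z t‖ :=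
      fun τ => by
      refine sobolevNorm_eq ?_
      have h2 : coeff (u τ - u t) = wt (-s) (Z τ - Z t : Seq) := by
        rw [coeff_sub, h, h]
        funext k
        simp only [wt, Pi.sub_apply, Seq.coe_sub, mul_sub]
      rw [h2, wt_wt_neg]
    simp only [h1]
    simpa using (tendsto_iff_norm_sub_tendsto_zero.mp (hZ t ht)).const_mul
      (Real.sqrt (2 * Real.pi))

/-! ### Well-posedness -/

/-- Since H^s embeds in L², it suffices to compare the solutions in L², where both become solutions
of one locally Lipschitz equation in the interaction picture. -/
theorem IsSolution.eqOn {c : ℝ} {a : ℝ → ℝ} (ha : IsSmoothPeriodic a) {s : ℝ} (hs : 0 ≤ s)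
    {T : ℝ} (hT : 0 < T) {u₀ : L2} {u v : ℝ → L2} (hu : IsSolution c a s T u₀ u)
    (hv : IsSolution c a s T u₀ v) : Set.EqOn u v (Set.Icc 0 T) := by
  have hb := rapidDecay_testCoeff ha
  have key : ∀ {w : ℝ → L2}, IsSolution c a s T u₀ w →
      SolvesODE (kdvField c hb 0 le_rfl 1 1) T (fun t => evol c (-t) (toSeq (w t))) :=
    fun hw => by
    have h1 := hw.continuousInSobolev.continuousOn_toSeq hs
    exact solvesODE_of_hasDerivWithinAt c hb hT.le h1
      (hw.solvesEquation.hasDerivWithinAt c ha hT h1)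
  have heq := (key hu).eqOn
    (isRegularField_kdvField c hb 0 le_rfl (α := 1) (β := 1) continuousOn_const
      continuousOn_const) (key hv) (by simp only [hu.initial, hv.initial])
  intro t ht
  have h1 := congrArg (evol c t) (heq ht)
  simp only [evol_evol_neg] at h1
  exact toSeq_injective h1

theorem exists_isSolution (c : ℝ) {a : ℝ → ℝ} (ha : IsSmoothPeriodic a) {s : ℝ} (hs : 0 ≤ s)
    {T : ℝ} (hT : 0 < T) {u₀ : L2} (hu₀ : MemSobolev s u₀) :
    ∃ u, IsSolution c a s T u₀ u := by
  have hb := rapidDecay_testCoeff ha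
  obtain ⟨y, hy0, hyr, hy⟩ := exists_solution_weighted c hb s hs (isReal_testCoeff ha.2) hT.le
    (x₀ := Seq.mk _ (memSobolev_iff.mp hu₀)) ((isReal_coeff u₀).wt s)
  have hZr : ∀ t, evol c t (y t) ∈ realSeq := fun t => IsReal.evol (hyr t) c t
  -- The sequences are real for every t, also outside [0,T], so u is defined on the whole line.
  choose u hu using fun t => exists_coeff_eq
    (mem_realSeq.mp (smoothing_mem_realSeq s hs _ (hZr t)))
  have hZc : ContinuousOn (fun t => evol c t (y t)) (Set.Icc 0 T) :=
    continuousOn_evol c continuousOn_id hy.continuousOn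
  have hcs : ContinuousInSobolev s T u := continuousInSobolev_of_coeff_eq hZc fun t => by
    rw [hu, coe_smoothing]
  have hy' : SolvesODE (kdvField c hb 0 le_rfl 1 1) T (fun t => smoothing s hs (y t)) :=
    fun t ht => by
    rw [← smoothing_kdvField]
    exact (smoothing s hs).hasFDerivAt.comp_hasDerivWithinAt t (hy t ht)
  have hueq : ∀ t, toSeq (u t) = evol c t (smoothing s hs (y t)) := fun t => by
    apply Seq.ext
    rw [coe_toSeq, hu, smoothing_evol]
  refine ⟨u, hcs, ?_, ?_⟩
  · refine solvesEquation_of_hasDerivWithinAt c ha hT (hcs.continuousOn_toSeq hs) fun k => ?_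
    simp only [hueq]
    exact hy'.hasDerivWithinAt_evol c hb k
  · apply toSeq_injective
    apply Seq.ext
    rw [hueq, hy0, evol_zero, coe_smoothing, Seq.coe_mk, wt_neg_wt, coe_toSeq]

end KdVBBM

end

/-! ### Existence and uniqueness for the closed-loop system -/

theorem theorem6p4 (c : ℝ) (hc : c ≠ 0) (a : ℝ → ℝ) (ha : KdVBBM.IsSmoothPeriodic a)
    (ha0 : a ≠ 0) (s : ℝ) (hs : 0 ≤ s) (T : ℝ) (hT : 0 < T)
    (u₀ : KdVBBM.L2) (hu₀ : KdVBBM.MemSobolev s u₀) :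
    ∃ u : ℝ → KdVBBM.L2, KdVBBM.IsSolution c a s T u₀ u ∧
      ∀ v : ℝ → KdVBBM.L2, KdVBBM.IsSolution c a s T u₀ v → Set.EqOn v u (Set.Icc 0 T) := by
  obtain ⟨u, hu⟩ := KdVBBM.exists_isSolution c ha hs hT hu₀
  exact ⟨u, hu, fun v hv => hv.eqOn ha hs hT hu⟩
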